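/- For $r>0$ let $\mathcal B_r^d$ be the set of Borel sets $B\subset\{x\in\mathbb R^d:|x|\ge r\}$, where $|\cdot|$ is the Euclidean norm, and let $\mathcal B_0^d=\bigcup_{r>0}\mathcal B_r^d$. Let $\nu:\mathcal B_0^d\to\mathbb R$ be a function whose restriction to $\mathcal B_r^d$ is a finite signed measure for every $r>0$. Its positive part $\nu^+$, negative part $\nu^-$ and total variation $|\nu|$ are the unique measures on $\mathbb R^d$ that give mass $0$ to $\{0\}$ and that coincide on each $\mathcal B_r^d$ with the positive part, the negative part and the total variation of $\nu_{|\mathcal B_r^d}$, respectively. A function is integrable with respect to $\nu$ if it is integrable with respect to $|\nu|$, and then $\int f\,d\nu:=\int f\,d\nu^+-\int f\,d\nu^-$. Such a $\nu$ is called a quasi-Lévy type measure on $\mathbb R^d$ if $x\mapsto\min(1,|x|^2)$ is integrable with respect to $\nu$. A representation function on $\mathbb R^d$ is a bounded Borel measurable function $c:\mathbb R^d\to\mathbb R^d$ with $\lim_{x\to0}|x|^{-2}|c(x)-x|=0$. A probability distribution $\mu$ on $\mathbb R^d$ is called quasi-infinitely divisible if there are infinitely divisible distributions $\mu_1,\mu_2$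 on $\mathbb R^d$ such that the characteristic functions satisfy $\widehat\mu(z)=\widehat\mu_1(z)/\widehat\mu_2(z)$ for all $z\in\mathbb R^d$. **Theorem.** Let $c$ be a representation function on $\mathbb R^d$. A probability distribution $\mu$ on $\mathbb R^d$ is quasi-infinitely divisible if and only if there are a symmetric matrix $A\in\mathbb R^{d\times d}$, a constant $\gamma\in\mathbb R^d$ and a quasi-Lévy type measure $\nu$ on $\mathbb R^d$ such that for all $z\in\mathbb R^d$ $$\widehat\mu(z)=\exp\Big(\mathrm i\langle\gamma,z\rangle-\tfrac12\langle z,Az\rangle+\int_{\mathbb R^d}\big(e^{\mathrm i\langle z,x\rangle}-1-\mathrm i\langle z,c(x)\rangle\big)\,\nu(dx)\Big).$$ In this case, the triplet $(A,\nu,\gamma)$ in this representation of $\widehat\mu$ is unique. -/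

import Mathlib

open MeasureTheory Filter Topology Function

namespace QID

/-- Euclidean space `ℝ^d` (Euclidean norm, Borel sigma-algebra). -/
abbrev E (d : ℕ) : Type := EuclideanSpace ℝ (Fin d)

/-! ### Infinitely divisible and quasi-infinitely divisible distributions -/

/-- The `n`-fold convolution of a measure with itself. -/
noncomputable def convPow {d : ℕ} (μ : Measure (E d)) : ℕ → Measure (E d)
  | 0 => Measure.dirac 0
  | n + 1 => (convPow μ n).conv μ

/-- A distribution is infinitely divisible if for every `n ≥ 1` it is the `n`-fold convolution of
some distribution with itself. -/
def IsInfinitelyDivisible {d : ℕ} (μ : Measure (E d)) : Prop :=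
  IsProbabilityMeasure μ ∧
    ∀ n : ℕ, 1 ≤ n → ∃ ρ : Measure (E d), IsProbabilityMeasure ρ ∧ convPow ρ n = μ

/-- A distribution is quasi-infinitely divisible if its characteristic function is the quotient of
the characteristic functions of two infinitely divisible distributions (the denominator has no
zeroes, by a classical theorem on infinitely divisible distributions). -/
def IsQuasiInfinitelyDivisible {d : ℕ} (μ : Measure (E d)) : Prop :=
  IsProbabilityMeasure μ ∧
    ∃ μ₁ μ₂ : Measure (E d), IsInfinitelyDivisible μ₁ ∧ IsInfinitelyDivisible μ₂ ∧
      ∀ z : E d, charFun μ z = charFun μ₁ z / charFun μ₂ z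

/-! ### Quasi-Lévy type measures -/

/-- The complement of the open ball of radius `r` around the origin. -/
def outer (d : ℕ) (r : ℝ) : Set (E d) := {x | r ≤ ‖x‖}

/-- The Borel sets contained in `{x : |x| ≥ r}`. -/
def Br (d : ℕ) (r : ℝ) : Set (Set (E d)) := {B | MeasurableSet B ∧ B ⊆ outer d r}

/-- The Borel sets bounded away from the origin: the union of all `Br d r` over `r > 0`. -/
def B0 (d : ℕ) : Set (Set (E d)) := {B | ∃ r : ℝ, 0 < r ∧ B ∈ Br d r}

lemma measurableSet_outer (d : ℕ) (r : ℝ) : MeasurableSet (outer d r) :=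
  measurableSet_le measurable_const measurable_norm

lemma outer_mono (d : ℕ) {r s : ℝ} (h : r ≤ s) : outer d s ⊆ outer d r :=
  fun _ hx => le_trans h hx

lemma empty_mem_B0 (d : ℕ) : (∅ : Set (E d)) ∈ B0 d :=
  ⟨1, one_pos, MeasurableSet.empty, Set.empty_subset _⟩

lemma iUnion_mem_B0 {d : ℕ} {r : ℝ} (hr : 0 < r) {f : ℕ → Set (E d)} (hf : ∀ i, f i ∈ Br d r) :
    (⋃ i, f i) ∈ B0 d :=
  ⟨r, hr, MeasurableSet.iUnion fun i => (hf i).1, Set.iUnion_subset fun i => (hf i).2⟩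

lemma inter_outer_mem_Br {d : ℕ} (r : ℝ) {B : Set (E d)} (hB : MeasurableSet B) :
    B ∩ outer d r ∈ Br d r :=
  ⟨hB.inter (measurableSet_outer d r), Set.inter_subset_right⟩

/-- A function `ν : B0 d → ℝ` whose restriction to `Br d r` is a finite signed measure for every
`r > 0`. -/
@[ext]
structure LocalSignedMeasure (d : ℕ) where
  /-- The underlying set function. -/
  toFun : B0 d → ℝ
  empty : toFun ⟨∅, empty_mem_B0 d⟩ = 0
  iUnion : ∀ (r : ℝ) (hr : 0 < r) (f : ℕ → Set (E d)) (hf : ∀ i, f i ∈ Br d r),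
    Pairwise (Disjoint on f) →
      HasSum (fun i => toFun ⟨f i, r, hr, hf i⟩) (toFun ⟨⋃ i, f i, iUnion_mem_B0 hr hf⟩)

namespace LocalSignedMeasure

variable {d : ℕ}

open Classical in
/-- The restriction of `ν` to `Br d r`, seen as a finite signed measure on `ℝ^d` which vanishes
outside of `{x : |x| ≥ r}`. -/
noncomputable def restr (ν : LocalSignedMeasure d) {r : ℝ} (hr : 0 < r) : SignedMeasure (E d) where
  measureOf' B :=
    if h : MeasurableSet B then ν.toFun ⟨B ∩ outer d r, r, hr, inter_outer_mem_Br r h⟩ else 0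
  empty' := by
    rw [dif_pos MeasurableSet.empty]
    exact (congrArg ν.toFun (Subtype.ext (Set.empty_inter _))).trans ν.empty
  not_measurable' := fun B h => dif_neg h
  m_iUnion' := by
    intro f hf hd
    have key := ν.iUnion r hr (fun i => f i ∩ outer d r) (fun i => inter_outer_mem_Br r (hf i))
      (fun i j hij => (hd hij).mono Set.inter_subset_left Set.inter_subset_left)
    rw [dif_pos (MeasurableSet.iUnion hf)]
    simp only [dif_pos (hf _)]
    rwa [show (⟨(⋃ i, f i) ∩ outer d r, r, hr, inter_outer_mem_Br r (MeasurableSet.iUnion hf)⟩ :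
      B0 d) = ⟨⋃ i, f i ∩ outer d r, _⟩ from Subtype.ext (Set.iUnion_inter _ _)]

open Classical in
lemma restr_apply (ν : LocalSignedMeasure d) {r : ℝ} (hr : 0 < r) {B : Set (E d)}
    (h : B ∈ Br d r) : ν.restr hr B = ν.toFun ⟨B, r, hr, h⟩ := by
  change (if h : MeasurableSet B then
    ν.toFun ⟨B ∩ outer d r, r, hr, inter_outer_mem_Br r h⟩ else 0) = _
  rw [dif_pos h.1]
  exact congrArg ν.toFun (Subtype.ext (Set.inter_eq_left.2 h.2))

open Classical in
lemma restr_restrict (ν : LocalSignedMeasure d) {r s : ℝ} (hr : 0 < r) (hrs : r ≤ s) :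
    (ν.restr hr).restrict (outer d s) = ν.restr (hr.trans_le hrs) := by
  ext B hB
  rw [VectorMeasure.restrict_apply _ (measurableSet_outer d s) hB,
    restr_apply ν hr ⟨hB.inter (measurableSet_outer d s),
      Set.inter_subset_right.trans (outer_mono d hrs)⟩]
  change _ = (if h : MeasurableSet B then
    ν.toFun ⟨B ∩ outer d s, s, hr.trans_le hrs, inter_outer_mem_Br s h⟩ else 0)
  rw [dif_pos hB]

/-- The annuli `{x : |x| ≥ 1}` and `{x : 1 / (n + 1) ≤ |x| < 1 / n}` for `n ≥ 1`, which form a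
partition of `ℝ^d` without the origin. -/
def annulus (d : ℕ) : ℕ → Set (E d) := disjointed fun n : ℕ => outer d (1 / ((n : ℝ) + 1))

lemma annulus_subset (n : ℕ) : annulus d n ⊆ outer d (1 / ((n : ℝ) + 1)) :=
  disjointed_subset _ n

lemma measurableSet_annulus (n : ℕ) : MeasurableSet (annulus d n) :=
  MeasurableSet.disjointed (fun _ => measurableSet_outer d _) n

lemma disjoint_annulus {i j : ℕ} (hij : i ≠ j) (B : Set (E d)) :
    Disjoint (B ∩ annulus d i) (B ∩ annulus d j) :=
  ((disjoint_disjointed _) hij).mono Set.inter_subset_right Set.inter_subset_right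

lemma iUnion_annulus : (⋃ n, annulus d n) = {(0 : E d)}ᶜ := by
  rw [annulus, iUnion_disjointed]
  ext x
  simp only [Set.mem_iUnion, Set.mem_compl_iff, Set.mem_singleton_iff, outer, Set.mem_ofPred_eq]
  constructor
  · rintro ⟨n, hn⟩ rfl
    rw [norm_zero] at hn
    have : (0 : ℝ) < 1 / ((n : ℝ) + 1) := by positivity
    linarith
  · intro hx
    obtain ⟨n, hn⟩ := exists_nat_one_div_lt (norm_pos_iff.2 hx)
    exact ⟨n, hn.le⟩

/-- The positive part of `ν`, a measure on `ℝ^d`: on each annulus it is the positive part in the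
Jordan decomposition of a restriction of `ν`, and the origin has mass zero. -/
noncomputable def posPart (ν : LocalSignedMeasure d) : Measure (E d) :=
  Measure.sum fun n : ℕ =>
    (ν.restr (r := 1 / ((n : ℝ) + 1)) (by positivity)).toJordanDecomposition.posPart.restrict
      (annulus d n)

/-- The negative part of `ν`, a measure on `ℝ^d`. -/
noncomputable def negPart (ν : LocalSignedMeasure d) : Measure (E d) :=
  Measure.sum fun n : ℕ =>
    (ν.restr (r := 1 / ((n : ℝ) + 1)) (by positivity)).toJordanDecomposition.negPart.restrict
      (annulus d n)

/-- The total variation of `ν`, a measure on `ℝ^d`. -/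
noncomputable def totalVariation (ν : LocalSignedMeasure d) : Measure (E d) :=
  ν.posPart + ν.negPart

/-- A function is integrable with respect to `ν` if it is integrable with respect to `|ν|`. -/
def Integrable {F : Type*} [NormedAddCommGroup F] (ν : LocalSignedMeasure d) (f : E d → F) : Prop :=
  MeasureTheory.Integrable f ν.totalVariation

/-- The integral of a complex valued function with respect to `ν`. -/
noncomputable def integral (ν : LocalSignedMeasure d) (f : E d → ℂ) : ℂ :=
  ∫ x, f x ∂ν.posPart - ∫ x, f x ∂ν.negPart

/-- `ν` is a quasi-Lévy type measure if `x ↦ 1 ∧ |x|²` is integrable with respect to `ν`. -/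
def IsQuasiLevyType (ν : LocalSignedMeasure d) : Prop :=
  ν.Integrable fun x : E d => min (1 : ℝ) (‖x‖ ^ 2)

/-! The next lemmas confirm that `posPart`, `negPart` and `totalVariation` are the unique measures
on `ℝ^d` which give no mass to the origin and which agree on `Br d r`, for all `r > 0`, with the
positive part, the negative part and the total variation of the restriction of `ν` to `Br d r`. -/

lemma toJordanDecomposition_restrict (σ : SignedMeasure (E d)) {S : Set (E d)}
    (hS : MeasurableSet S) :
    (SignedMeasure.toJordanDecomposition (σ.restrict S)).posPart = σ.toJordanDecomposition.posPart.restrict S ∧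
    (SignedMeasure.toJordanDecomposition (σ.restrict S)).negPart = σ.toJordanDecomposition.negPart.restrict S := by
  let j : JordanDecomposition (E d) :=
    { posPart := σ.toJordanDecomposition.posPart.restrict S
      negPart := σ.toJordanDecomposition.negPart.restrict S
      mutuallySingular := σ.toJordanDecomposition.mutuallySingular.mono
        Measure.restrict_le_self Measure.restrict_le_self }
  have hj : (SignedMeasure.toJordanDecomposition (σ.restrict S)) = j := by
    apply SignedMeasure.toJordanDecomposition_eq
    ext B hB
    rw [VectorMeasure.restrict_apply _ hS hB,
      SignedMeasure.apply_eq_posPart_real_sub_negPart_real σ (hB.inter hS)]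
    simp only [JordanDecomposition.toSignedMeasure, j]
    rw [Measure.toSignedMeasure_sub_apply hB, measureReal_restrict_apply hB, measureReal_restrict_apply hB]
  rw [hj]
  exact ⟨rfl, rfl⟩

lemma restr_parts_eq (ν : LocalSignedMeasure d) {r s : ℝ} (hr : 0 < r) (hs : 0 < s) {B : Set (E d)}
    (hB : B ∈ Br d r) (hB' : B ∈ Br d s) :
    (ν.restr hr).toJordanDecomposition.posPart B = (ν.restr hs).toJordanDecomposition.posPart B ∧
    (ν.restr hr).toJordanDecomposition.negPart B = (ν.restr hs).toJordanDecomposition.negPart B := by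
  wlog h : r ≤ s generalizing r s
  · have := this hs hr hB' hB (le_of_not_ge h)
    exact ⟨this.1.symm, this.2.symm⟩
  obtain ⟨hp, hn⟩ := toJordanDecomposition_restrict (ν.restr hr) (measurableSet_outer d s)
  rw [restr_restrict ν hr h] at hp hn
  rw [hp, hn, Measure.restrict_apply hB.1, Measure.restrict_apply hB.1,
    Set.inter_eq_left.2 hB'.2]
  exact ⟨rfl, rfl⟩

lemma tsum_annulus (m : Measure (E d)) {r : ℝ} (hr : 0 < r) {B : Set (E d)} (hB : B ∈ Br d r) :
    ∑' n, m (B ∩ annulus d n) = m B := by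
  rw [← measure_iUnion (fun i j hij => disjoint_annulus hij B)
    (fun n => hB.1.inter (measurableSet_annulus n)), ← Set.inter_iUnion, iUnion_annulus]
  congr 1
  refine Set.inter_eq_left.2 fun x hx h0 => ?_
  have h1 : r ≤ ‖x‖ := hB.2 hx
  rw [Set.mem_singleton_iff.1 h0, norm_zero] at h1
  linarith

lemma inter_annulus_mem {r : ℝ} {B : Set (E d)} (hB : B ∈ Br d r) (n : ℕ) :
    B ∩ annulus d n ∈ Br d (1 / ((n : ℝ) + 1)) ∧ B ∩ annulus d n ∈ Br d r :=
  ⟨⟨hB.1.inter (measurableSet_annulus n), Set.inter_subset_right.trans (annulus_subset n)⟩,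
    ⟨hB.1.inter (measurableSet_annulus n), Set.inter_subset_left.trans hB.2⟩⟩

lemma posPart_apply (ν : LocalSignedMeasure d) {r : ℝ} (hr : 0 < r) {B : Set (E d)}
    (hB : B ∈ Br d r) : ν.posPart B = (ν.restr hr).toJordanDecomposition.posPart B := by
  rw [posPart, Measure.sum_apply _ hB.1, ← tsum_annulus _ hr hB]
  refine tsum_congr fun n => ?_
  rw [Measure.restrict_apply hB.1]
  exact (restr_parts_eq ν _ hr (inter_annulus_mem hB n).1 (inter_annulus_mem hB n).2).1

lemma negPart_apply (ν : LocalSignedMeasure d) {r : ℝ} (hr : 0 < r) {B : Set (E d)}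
    (hB : B ∈ Br d r) : ν.negPart B = (ν.restr hr).toJordanDecomposition.negPart B := by
  rw [negPart, Measure.sum_apply _ hB.1, ← tsum_annulus _ hr hB]
  refine tsum_congr fun n => ?_
  rw [Measure.restrict_apply hB.1]
  exact (restr_parts_eq ν _ hr (inter_annulus_mem hB n).1 (inter_annulus_mem hB n).2).2

lemma totalVariation_apply (ν : LocalSignedMeasure d) {r : ℝ} (hr : 0 < r) {B : Set (E d)}
    (hB : B ∈ Br d r) : ν.totalVariation B = (ν.restr hr).totalVariation B := by
  rw [totalVariation, SignedMeasure.totalVariation, Measure.add_apply, Measure.add_apply,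
    posPart_apply ν hr hB, negPart_apply ν hr hB]

lemma zero_inter_annulus (n : ℕ) : ({0} : Set (E d)) ∩ annulus d n = ∅ := by
  refine Set.disjoint_iff_inter_eq_empty.1 (Set.disjoint_left.2 fun x hx hx' => ?_)
  have h1 : x ∈ ⋃ n, annulus d n := Set.mem_iUnion.2 ⟨n, hx'⟩
  rw [iUnion_annulus] at h1
  exact h1 hx

lemma posPart_zero (ν : LocalSignedMeasure d) : ν.posPart {0} = 0 := by
  rw [posPart, Measure.sum_apply _ (measurableSet_singleton 0)]
  simp [Measure.restrict_apply, zero_inter_annulus]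

lemma negPart_zero (ν : LocalSignedMeasure d) : ν.negPart {0} = 0 := by
  rw [negPart, Measure.sum_apply _ (measurableSet_singleton 0)]
  simp [Measure.restrict_apply, zero_inter_annulus]

lemma totalVariation_zero (ν : LocalSignedMeasure d) : ν.totalVariation {0} = 0 := by
  simp [totalVariation, posPart_zero, negPart_zero]

lemma measure_eq_of_eq_on_B0 {m₁ m₂ : Measure (E d)} (h1 : m₁ {0} = 0) (h2 : m₂ {0} = 0)
    (h : ∀ B ∈ B0 d, m₁ B = m₂ B) : m₁ = m₂ := by
  have key : ∀ m : Measure (E d), m {0} = 0 → ∀ B : Set (E d), MeasurableSet B →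
      m B = ∑' n, m (B ∩ annulus d n) := by
    intro m hm B hB
    rw [← measure_iUnion (fun i j hij => disjoint_annulus hij B)
      (fun n => hB.inter (measurableSet_annulus n)), ← Set.inter_iUnion, iUnion_annulus,
      ← Set.sdiff_eq, measure_sdiff_null hm]
  ext B hB
  rw [key m₁ h1 B hB, key m₂ h2 B hB]
  refine tsum_congr fun n => h _ ⟨1 / ((n : ℝ) + 1), by positivity, ?_⟩
  exact ⟨hB.inter (measurableSet_annulus n), Set.inter_subset_right.trans (annulus_subset n)⟩

end LocalSignedMeasure

/-! ### The Lévy-Khintchine type representation -/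

/-- Representation functions on `ℝ^d`. -/
structure IsRepresentationFunction {d : ℕ} (c : E d → E d) : Prop where
  bounded : ∃ C : ℝ, ∀ x, ‖c x‖ ≤ C
  measurable : Measurable c
  tendsto : Tendsto (fun x : E d => (‖x‖ ^ 2)⁻¹ * ‖c x - x‖) (𝓝[≠] 0) (𝓝 0)

/-- The exponent `i⟨γ,z⟩ - ½⟨z,Az⟩ + ∫ (exp(i⟨z,x⟩) - 1 - i⟨z,c(x)⟩) ν(dx)`. -/
noncomputable def exponent {d : ℕ} (c : E d → E d) (A : Matrix (Fin d) (Fin d) ℝ)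
    (ν : LocalSignedMeasure d) (γ : E d) (z : E d) : ℂ :=
  Complex.I * ((inner ℝ γ z : ℝ) : ℂ) - (1 / 2 : ℂ) * ((inner ℝ z (Matrix.toEuclideanLin A z) : ℝ) : ℂ) +
    ν.integral fun x =>
      Complex.exp (Complex.I * ((inner ℝ z x : ℝ) : ℂ)) - 1 - Complex.I * ((inner ℝ z (c x) : ℝ) : ℂ)

/-- The characteristic function of `μ` has the Lévy-Khintchine type representation with respect to
`c` with symmetric matrix `A`, quasi-Lévy type measure `ν` and constant `γ`. -/
def HasLevyKhintchineRep {d : ℕ} (c : E d → E d) (μ : Measure (E d))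
    (A : Matrix (Fin d) (Fin d) ℝ) (ν : LocalSignedMeasure d) (γ : E d) : Prop :=
  A.IsSymm ∧ ν.IsQuasiLevyType ∧ ∀ z : E d, charFun μ z = Complex.exp (exponent c A ν γ z)

end QID

namespace QID

variable {d : ℕ}

/-! Everything rests on the Lévy-Khintchine formula for infinitely divisible laws, proved here by
second differences. Such a law has a nonvanishing characteristic function, hence a continuous
logarithm `ψ`, and `exp (ψ / (n + 1))` is the characteristic function of a probability measure `ρ
n`. The functions `(n + 1) * (exp (ψ / (n + 1)) - 1)` tend to `ψ`. Taking a second difference in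
direction `w` kills the constant and multiplies measures by `osc w x = 1 - cos ⟨x, w⟩`, so
`secondDiff w ψ` is a limit of transforms of finite measures, hence the transform of a finite
measure `K w`. An average over coordinate directions gives a single finite measure `G` in the same
way, with a multiplier `avgOsc` comparable from below to `min 1 |x|²`. Because second differences
commute, `avgOsc • K w = osc w • G`. So off the origin every `K w` has density `osc w` with respect
to one measure, `G / avgOsc`, which is the Lévy measure (`exists_levyMeasure`); the atom of `K w` at
the origin is the Gaussian contribution. Subtracting the Lévy integral from `ψ` leaves a function
with constant real second differences, which is linear plus quadratic (`exists_quadratic_eq`).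

Forward direction: subtract the triplets of numerator and denominator; `integral_ofLevy` makes this
legitimate although the two Lévy measures may overlap. Converse: split `ν` into its positive and
negative parts and `A` into a difference of squares of symmetric matrices;
`IsLevyMeasure.exists_infinitelyDivisible` realises each half through compound Poisson, Gaussian and
Dirac factors. Uniqueness: two exponents of the same law are continuous logarithms agreeing at the
origin, hence equal. After moving negative parts across, second differences compare finite measures
having no atom at the origin, which separates the Gaussian part from the Lévy measure
(`levyTriplet_unique`). -/

/-! ### Lévy's continuity theorem -/

/-- A pointwise limit of characteristic functions of probability measures which is continuous at
the origin is the characteristic function of a probability measure. -/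
lemma exists_probability_charFun_eq {ρ : ℕ → Measure (E d)} [∀ n, IsProbabilityMeasure (ρ n)]
    {f : E d → ℂ} (hf : ContinuousAt f 0)
    (h : ∀ z, Tendsto (fun n => charFun (ρ n) z) atTop (𝓝 (f z))) :
    ∃ ρ' : Measure (E d), IsProbabilityMeasure ρ' ∧ ∀ z, charFun ρ' z = f z := by
  have htight := isTightMeasureSet_of_tendsto_charFun hf h
  let P : ℕ → ProbabilityMeasure (E d) := fun n => ⟨ρ n, inferInstance⟩
  have hcomp : IsCompact (closure (Set.range P)) := by
    apply isCompact_closure_of_isTightMeasureSet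
    have hrange : {x | ∃ m ∈ Set.range P, (m : Measure (E d)) = x} = Set.range ρ := by
      ext m
      exact ⟨fun ⟨_, ⟨n, hn⟩, hm⟩ => ⟨n, by rw [← hm, ← hn]; rfl⟩,
        fun ⟨n, hn⟩ => ⟨P n, ⟨n, rfl⟩, hn⟩⟩
    rwa [hrange]
  -- A cluster point along a nonprincipal ultrafilter suffices: the characteristic functions already
  -- converge along `atTop`, so their limit along the ultrafilter is the same.
  obtain ⟨ρ', -, hρ'⟩ := hcomp.ultrafilter_le_nhds ((hyperfilter ℕ).map P)
    (.trans (by simp) (monotone_principal subset_closure))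
  have hρ'' : Tendsto P (hyperfilter ℕ) (𝓝 ρ') := hρ'
  rw [ProbabilityMeasure.tendsto_iff_forall_integral_rclike_tendsto ℂ] at hρ''
  refine ⟨ρ', inferInstance, fun z => ?_⟩
  have h1 := hρ'' (BoundedContinuousFunction.innerProbChar z)
  have h2 : Tendsto (fun n => charFun (ρ n) z) (hyperfilter ℕ) (𝓝 (f z)) :=
    (h z).mono_left (by rw [← Nat.cofinite_eq_atTop]; exact hyperfilter_le_cofinite)
  simp_rw [← charFun_eq_integral_innerProbChar] at h1
  exact tendsto_nhds_unique h1 h2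

/-- The version of `exists_probability_charFun_eq` for finite measures. -/
lemma exists_finite_charFun_eq {ρ : ℕ → Measure (E d)} [∀ n, IsFiniteMeasure (ρ n)]
    {f : E d → ℂ} (hf : Continuous f)
    (h : ∀ z, Tendsto (fun n => charFun (ρ n) z) atTop (𝓝 (f z))) :
    ∃ ρ' : Measure (E d), IsFiniteMeasure ρ' ∧ ∀ z, charFun ρ' z = f z := by
  have h0 := h 0
  simp_rw [charFun_zero] at h0
  have hre : Tendsto (fun n => (ρ n).real Set.univ) atTop (𝓝 (f 0).re) := by
    simpa [Function.comp_def] using (Complex.continuous_re.tendsto _).comp h0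
  have hf0 : f 0 = ((f 0).re : ℂ) :=
    tendsto_nhds_unique h0 ((Complex.continuous_ofReal.tendsto _).comp hre)
  rcases eq_or_ne (f 0).re 0 with hz | hz
  · refine ⟨0, inferInstance, fun z => ?_⟩
    have h2 : Tendsto (fun n => ‖charFun (ρ n) z‖) atTop (𝓝 0) :=
      squeeze_zero (fun _ => norm_nonneg _) (fun n => norm_charFun_le z) (hz ▸ hre)
    rw [charFun_zero_measure]
    exact tendsto_nhds_unique (tendsto_zero_iff_norm_tendsto_zero.2 h2) (h z)
  · have hpos : 0 < (f 0).re :=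
      lt_of_le_of_ne (ge_of_tendsto' hre fun n => measureReal_nonneg) hz.symm
    -- The total masses converge to a positive number, so from index `N` on the measures can be
    -- normalised.
    obtain ⟨N, hN⟩ := eventually_atTop.1 (hre.eventually (lt_mem_nhds hpos))
    let s : ℕ → Measure (E d) := fun n =>
      ((ρ (n + N)) Set.univ)⁻¹ • ρ (n + N)
    have hs : ∀ n, IsProbabilityMeasure (s n) := fun n => by
      have : NeZero (ρ (n + N)) := ⟨fun h0 => by
        have := hN (n + N) (by omega)
        simp [h0] at this⟩
      exact isProbabilityMeasureSMul
    have hsc : ∀ n z, charFun (s n) z =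
        (((ρ (n + N)).real Set.univ : ℝ) : ℂ)⁻¹ * charFun (ρ (n + N)) z := fun n z => by
      simp only [s, charFun_apply, integral_smul_measure]
      simp [Measure.real]
    obtain ⟨ρ', hp, hρ'⟩ := exists_probability_charFun_eq (ρ := s)
      (f := fun z => ((f 0).re : ℂ)⁻¹ * f z) (by fun_prop) (fun z => by
        simp_rw [hsc]
        refine Tendsto.mul ?_ ((h z).comp (tendsto_add_atTop_nat N))
        refine Tendsto.inv₀ ?_ (by exact_mod_cast hz)
        exact ((Complex.continuous_ofReal.tendsto _).comp hre).comp (tendsto_add_atTop_nat N))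
    refine ⟨ENNReal.ofReal (f 0).re • ρ', ρ'.smul_finite ENNReal.ofReal_ne_top, fun z => ?_⟩
    rw [charFun_apply, integral_smul_measure, ← charFun_apply, hρ',
      ENNReal.toReal_ofReal hpos.le, Complex.real_smul, ← mul_assoc,
      mul_inv_cancel₀ (by exact_mod_cast hz), one_mul]

/-! ### Continuous logarithms -/

/-- Both functions lift the same map through the covering `exp`; on a connected space lifts agreeing
at one point coincide. -/
lemma eq_of_exp_eq {f g : E d → ℂ} (hf : Continuous f) (hg : Continuous g) (h0 : f 0 = g 0)
    (h : ∀ z, Complex.exp (f z) = Complex.exp (g z)) : f = g :=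
  Complex.isCoveringMap_exp.eq_of_comp_eq hf hg
    (funext fun z => Subtype.ext (h z)) 0 h0

lemma exists_continuous_log {f : E d → ℂ} (hf : Continuous f) (h0 : f 0 = 1)
    (hne : ∀ z, f z ≠ 0) :
    ∃ ψ : E d → ℂ, Continuous ψ ∧ ψ 0 = 0 ∧ ∀ z, f z = Complex.exp (ψ z) := by
  obtain ⟨F, ⟨hF0, hF⟩, -⟩ := Complex.isCoveringMapOn_exp.existsUnique_continuousMap_lifts
    (⟨f, hf⟩ : C(E d, ℂ)) (a₀ := 0) (e₀ := 0) (by simp [h0]) hne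
  exact ⟨F, F.continuous, hF0, fun z => (congrFun hF z).symm⟩

/-! ### Infinitely divisible distributions -/

lemma isProbabilityMeasure_convPow (ρ : Measure (E d)) [IsProbabilityMeasure ρ] (n : ℕ) :
    IsProbabilityMeasure (convPow ρ n) := by
  induction n with
  | zero => exact Measure.dirac.isProbabilityMeasure
  | succ n ih => rw [convPow]; infer_instance

lemma charFun_convPow (ρ : Measure (E d)) [IsProbabilityMeasure ρ] (n : ℕ) (z : E d) :
    charFun (convPow ρ n) z = charFun ρ z ^ n := by
  induction n with
  | zero => simp [convPow]
  | succ n ih =>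
    have := isProbabilityMeasure_convPow ρ n
    rw [convPow, charFun_conv, ih, pow_succ]

/-- Symmetrisation: convolve with the reflected measure, whose characteristic function is the
conjugate. -/
lemma exists_charFun_eq_normSq (ρ : Measure (E d)) [IsProbabilityMeasure ρ] :
    ∃ σ : Measure (E d), IsProbabilityMeasure σ ∧
      ∀ z, charFun σ z = ((‖charFun ρ z‖ ^ 2 : ℝ) : ℂ) := by
  have : IsProbabilityMeasure (ρ.map fun x => (-1 : ℝ) • x) :=
    Measure.isProbabilityMeasure_map (by fun_prop)
  refine ⟨ρ.conv (ρ.map fun x => (-1 : ℝ) • x), inferInstance, fun z => ?_⟩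
  rw [charFun_conv, charFun_map_smul, neg_one_smul, charFun_neg, Complex.mul_conj,
    Complex.normSq_eq_norm_sq]

/-- The characteristic function of an infinitely divisible distribution has no zeroes. -/
lemma IsInfinitelyDivisible.charFun_ne_zero {μ : Measure (E d)} (h : IsInfinitelyDivisible μ)
    (z : E d) : charFun μ z ≠ 0 := by
  have := h.1
  choose ρ hρ hρμ using fun n : ℕ => h.2 (n + 1) (by omega)
  choose σ hσ hσρ using fun n : ℕ => exists_charFun_eq_normSq (ρ n)
  have hpow : ∀ n z, ‖charFun (ρ n) z‖ ^ 2 = (‖charFun μ z‖ ^ 2) ^ (1 / ((n : ℝ) + 1)) := by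
    intro n z
    rw [← hρμ n, charFun_convPow, norm_pow, ← pow_mul, mul_comm, pow_mul, ← Nat.cast_succ,
      one_div, Real.pow_rpow_inv_natCast (by positivity) (by omega)]
  classical
  -- The pointwise limit of `|charFun μ| ^ (2 / (n + 1))`. Passing to the squared modulus allows
  -- real roots, with no choice of branch.
  let f : E d → ℂ := fun z => if charFun μ z = 0 then 0 else 1
  have hlim : ∀ z, Tendsto (fun n => charFun (σ n) z) atTop (𝓝 (f z)) := by
    intro z
    simp_rw [hσρ, hpow]
    by_cases hz : charFun μ z = 0
    · simp only [hz, f, if_true]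
      refine tendsto_const_nhds.congr fun n => ?_
      rw [norm_zero, zero_pow two_ne_zero, Real.zero_rpow (by positivity), Complex.ofReal_zero]
    · simp only [hz, f, if_false]
      have h1 : Tendsto (fun n : ℕ => (‖charFun μ z‖ ^ 2) ^ (1 / ((n : ℝ) + 1))) atTop (𝓝 1) := by
        have := (tendsto_const_nhds (x := ‖charFun μ z‖ ^ 2)).rpow
          tendsto_one_div_add_atTop_nhds_zero_nat (Or.inl (by positivity))
        simpa using this
      simpa only [Complex.ofReal_one] using! (Complex.continuous_ofReal.tendsto _).comp h1
  have hcont : Continuous (charFun μ) := continuous_charFun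
  have hf0 : ContinuousAt f 0 := by
    have : ∀ᶠ z in 𝓝 (0 : E d), f z = 1 := by
      have h1 : charFun μ 0 ≠ 0 := by simp
      filter_upwards [hcont.continuousAt.eventually_ne h1] with z hz
      simp [f, hz]
    exact (continuousAt_const (y := (1 : ℂ))).congr (this.mono fun z hz => hz.symm)
  obtain ⟨τ, hτ, hτf⟩ := exists_probability_charFun_eq hf0 hlim
  have hfc : Continuous f := by
    rw [← funext hτf]
    exact continuous_charFun
  -- `f` is now continuous with values in `{0, 1}`, so the zero set is clopen in a connected space,
  -- and it misses the origin.
  have hclopen : IsClopen {z | charFun μ z = 0} := by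
    refine ⟨isClosed_eq hcont continuous_const, ?_⟩
    have : {z | charFun μ z = 0} = f ⁻¹' {1}ᶜ := by
      ext z
      by_cases hz : charFun μ z = 0 <;> simp [f, hz]
    rw [this]
    exact isOpen_compl_singleton.preimage hfc
  rcases isClopen_iff.1 hclopen with h1 | h1
  · intro hz
    have : z ∈ {z | charFun μ z = 0} := hz
    simp [h1] at this
  · have : (0 : E d) ∈ {z | charFun μ z = 0} := by simp [h1]
    simp at this

/-- The characteristic exponent of an infinitely divisible distribution. -/
lemma IsInfinitelyDivisible.exists_exponent {μ : Measure (E d)} (h : IsInfinitelyDivisible μ) :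
    ∃ ψ : E d → ℂ, Continuous ψ ∧ ψ 0 = 0 ∧ (∀ z, charFun μ z = Complex.exp (ψ z)) ∧
      ∀ n : ℕ, ∃ ρ : Measure (E d), IsProbabilityMeasure ρ ∧
        ∀ z, charFun ρ z = Complex.exp (ψ z / ((n : ℂ) + 1)) := by
  have := h.1
  obtain ⟨ψ, hψ, hψ0, hexp⟩ := exists_continuous_log (f := charFun μ) continuous_charFun (by simp)
    h.charFun_ne_zero
  refine ⟨ψ, hψ, hψ0, hexp, fun n => ?_⟩
  obtain ⟨ρ, hρ, hρμ⟩ := h.2 (n + 1) (by omega)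
  have hpow : ∀ z, charFun ρ z ^ (n + 1) = charFun μ z := fun z => by
    rw [← hρμ, charFun_convPow]
  obtain ⟨ψ', hψ', hψ'0, hexp'⟩ := exists_continuous_log (f := charFun ρ) continuous_charFun
    (by simp) (fun z hz => h.charFun_ne_zero z (by rw [← hpow, hz, zero_pow (by omega)]))
  have hn : (n : ℂ) + 1 ≠ 0 := Nat.cast_add_one_ne_zero n
  -- Both sides are continuous logarithms of `charFun μ` vanishing at the origin.
  have key : (fun z => ((n : ℂ) + 1) * ψ' z) = ψ := by
    refine eq_of_exp_eq (by fun_prop) hψ (by simp [hψ0, hψ'0]) fun z => ?_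
    rw [← hexp, ← hpow, hexp', ← Complex.exp_nat_mul]
    push_cast
    rfl
  refine ⟨ρ, hρ, fun z => ?_⟩
  rw [hexp', ← key, mul_div_cancel_left₀ _ hn]

/-! ### Measures with a density -/

/-- The measure with density `g` with respect to `m`. -/
noncomputable def weighted (m : Measure (E d)) (g : E d → ℝ) : Measure (E d) :=
  m.withDensity fun x => ENNReal.ofReal (g x)

lemma integral_weighted (m : Measure (E d)) {g : E d → ℝ} (hg : Measurable g) (h0 : ∀ x, 0 ≤ g x)
    (f : E d → ℂ) : ∫ x, f x ∂(weighted m g) = ∫ x, (g x : ℂ) * f x ∂m := by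
  rw [weighted, integral_withDensity_eq_integral_toReal_smul (by fun_prop) (by simp)]
  refine integral_congr_ae (.of_forall fun x => ?_)
  simp [ENNReal.toReal_ofReal (h0 x)]

lemma isFiniteMeasure_weighted {m : Measure (E d)} {g : E d → ℝ}
    (hg : MeasureTheory.Integrable g m) : IsFiniteMeasure (weighted m g) :=
  isFiniteMeasure_withDensity_ofReal hg.2

/-- The Fourier kernel is bounded. -/
lemma norm_fourier_kernel (x z : E d) : ‖Complex.exp ((inner ℝ x z : ℝ) * Complex.I)‖ = 1 :=
  Complex.norm_exp_ofReal_mul_I _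

/-! ### Second differences -/

/-- The second difference of `f` in direction `w`, up to the factor `-1/2`. -/
noncomputable def secondDiff (w : E d) (f : E d → ℂ) (z : E d) : ℂ :=
  f z - (f (z + w) + f (z - w)) / 2

/-- The multiplier `1 - cos⟨x, w⟩` which corresponds to the second difference in direction `w`. -/
noncomputable def osc (w x : E d) : ℝ := 1 - Real.cos (inner ℝ x w)

lemma osc_nonneg (w x : E d) : 0 ≤ osc w x := sub_nonneg.2 (Real.cos_le_one _)

lemma osc_le_two (w x : E d) : osc w x ≤ 2 := by
  have := Real.neg_one_le_cos (inner ℝ x w)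
  rw [osc]
  linarith

lemma osc_zero_right (w : E d) : osc w 0 = 0 := by simp [osc]

@[fun_prop]
lemma continuous_osc (w : E d) : Continuous (osc w) := by
  unfold osc
  fun_prop

lemma measurable_osc (w : E d) : Measurable (osc w) := (continuous_osc w).measurable

lemma osc_le (w x : E d) : osc w x ≤ (2 + ‖w‖ ^ 2) * min 1 (‖x‖ ^ 2) := by
  rcases le_total 1 (‖x‖ ^ 2) with h | h
  · rw [min_eq_left h]
    nlinarith [osc_le_two w x, sq_nonneg ‖w‖]
  · rw [min_eq_right h]
    have h1 := Real.one_sub_sq_div_two_le_cos (x := inner ℝ x w)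
    have h2 := abs_real_inner_le_norm x w
    have h3 : (inner ℝ x w) ^ 2 ≤ (‖x‖ * ‖w‖) ^ 2 := sq_le_sq' (abs_le.1 h2).1 (abs_le.1 h2).2
    rw [osc]
    nlinarith [sq_nonneg ‖x‖, sq_nonneg (‖x‖ * ‖w‖)]

lemma fourier_kernel_secondDiff (w x z : E d) :
    Complex.exp ((inner ℝ x z : ℝ) * Complex.I) -
      (Complex.exp ((inner ℝ x (z + w) : ℝ) * Complex.I) +
        Complex.exp ((inner ℝ x (z - w) : ℝ) * Complex.I)) / 2 =
      (osc w x : ℂ) * Complex.exp ((inner ℝ x z : ℝ) * Complex.I) := by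
  rw [inner_add_right, inner_sub_right, osc]
  push_cast
  rw [add_mul, sub_mul, Complex.exp_add, Complex.exp_sub, Complex.cos, neg_mul,
    Complex.exp_neg]
  have := Complex.exp_ne_zero ((inner ℝ x w : ℝ) * Complex.I)
  field_simp

lemma integrable_fourier_kernel (m : Measure (E d)) [IsFiniteMeasure m] (z : E d) :
    MeasureTheory.Integrable (fun x => Complex.exp ((inner ℝ x z : ℝ) * Complex.I)) m :=
  Integrable.of_bound (by fun_prop) 1 (.of_forall fun x => (norm_fourier_kernel x z).le)

/-- Translations of the transform are modulations of the measure, so the second difference becomes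
multiplication by `1 - cos`. This nonnegative, bounded factor of order `|x|²` at the origin is what
tames the Lévy measure. -/
lemma secondDiff_charFun (m : Measure (E d)) [IsFiniteMeasure m] (w z : E d) :
    secondDiff w (charFun m) z = charFun (weighted m (osc w)) z := by
  rw [charFun_apply (μ := weighted _ _), integral_weighted m (measurable_osc w) (osc_nonneg w),
    secondDiff]
  simp_rw [charFun_apply]
  rw [← integral_add (integrable_fourier_kernel m _) (integrable_fourier_kernel m _),
    ← integral_div, ← integral_sub (integrable_fourier_kernel m _)]
  · exact integral_congr_ae (.of_forall fun x => fourier_kernel_secondDiff w x z)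
  · exact ((integrable_fourier_kernel m _).add (integrable_fourier_kernel m _)).div_const 2

lemma secondDiff_comm (v w : E d) (f : E d → ℂ) (z : E d) :
    secondDiff v (secondDiff w f) z = secondDiff w (secondDiff v f) z := by
  simp only [secondDiff]
  rw [show z + v + w = z + w + v by abel, show z + v - w = z - w + v by abel,
    show z - v + w = z + w - v by abel, show z - v - w = z - w - v by abel]
  ring

lemma secondDiff_sub (w : E d) (f g : E d → ℂ) (z : E d) :
    secondDiff w (fun z => f z - g z) z = secondDiff w f z - secondDiff w g z := by
  simp only [secondDiff]
  ring

@[fun_prop]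
lemma continuous_secondDiff {f : E d → ℂ} (hf : Continuous f) (w : E d) :
    Continuous (secondDiff w f) := by
  unfold secondDiff
  fun_prop

/-! ### Averaged second differences -/

/-- The standard basis vectors. -/
noncomputable def basisVec (j : Fin d) : E d := EuclideanSpace.single j 1

/-- Second differences averaged over short steps in the coordinate directions. -/
noncomputable def avgDiff (f : E d → ℂ) (z : E d) : ℂ :=
  ∑ j : Fin d, ∫ t in (0 : ℝ)..1, secondDiff (t • basisVec j) f z

/-- The multiplier which corresponds to `avgDiff`. -/
noncomputable def avgOsc (x : E d) : ℝ :=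
  ∑ j : Fin d, ∫ t in (0 : ℝ)..1, osc (t • basisVec j) x

lemma continuous_avgOsc : Continuous (avgOsc (d := d)) := by
  unfold avgOsc
  refine continuous_finsetSum _ fun j _ => ?_
  refine intervalIntegral.continuous_parametric_intervalIntegral_of_continuous' ?_ 0 1
  unfold osc
  fun_prop

lemma continuous_avgDiff {f : E d → ℂ} (hf : Continuous f) : Continuous (avgDiff f) := by
  unfold avgDiff
  refine continuous_finsetSum _ fun j _ => ?_
  refine intervalIntegral.continuous_parametric_intervalIntegral_of_continuous' ?_ 0 1
  unfold secondDiff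
  fun_prop

lemma avgOsc_nonneg (x : E d) : 0 ≤ avgOsc x :=
  Finset.sum_nonneg fun _ _ =>
    intervalIntegral.integral_nonneg zero_le_one fun _ _ => osc_nonneg _ _

lemma continuous_osc_smul (j : Fin d) (x : E d) : Continuous fun t : ℝ => osc (t • basisVec j) x := by
  unfold osc
  fun_prop

lemma continuous_secondDiff_smul {f : E d → ℂ} (hf : Continuous f) (j : Fin d) (z : E d) :
    Continuous fun t : ℝ => secondDiff (t • basisVec j) f z := by
  unfold secondDiff
  fun_prop

lemma avgOsc_le (x : E d) : avgOsc x ≤ 2 * d := by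
  have : avgOsc x ≤ ∑ j : Fin d, (2 : ℝ) := by
    refine Finset.sum_le_sum fun j _ => ?_
    calc ∫ t in (0 : ℝ)..1, osc (t • basisVec j) x ≤ ∫ t in (0 : ℝ)..1, (2 : ℝ) :=
          intervalIntegral.integral_mono_on zero_le_one
            ((continuous_osc_smul j x).intervalIntegrable _ _) (by simp)
            fun t _ => osc_le_two _ _
      _ = 2 := by simp
  simpa [mul_comm] using this

/-- For `|u| ≤ π` use `1 - cos s ≥ (2 / π²) s² ≥ s² / 5`; integrating `t²` gives the factor `1/3`,
hence `1/15`. For `|u| ≥ π` the integral is `1 - sin u / u ≥ 2/3`. Averaging over `t` removes the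
zeros of `1 - cos` at nonzero multiples of `2π`. -/
lemma min_one_sq_le_integral_one_sub_cos (u : ℝ) :
    1 / 15 * min 1 (u ^ 2) ≤ ∫ t in (0 : ℝ)..1, (1 - Real.cos (t * u)) := by
  have hpi := Real.pi_gt_three
  have hpi' := Real.pi_lt_d2
  rcases le_total |u| Real.pi with h | h
  · have h1 : ∫ t in (0 : ℝ)..1, (1 / 5 * u ^ 2) * t ^ 2 = 1 / 15 * u ^ 2 := by
      rw [intervalIntegral.integral_const_mul, integral_pow]
      norm_num
      ring
    calc 1 / 15 * min 1 (u ^ 2) ≤ 1 / 15 * u ^ 2 := by gcongr; exact min_le_right _ _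
      _ = ∫ t in (0 : ℝ)..1, (1 / 5 * u ^ 2) * t ^ 2 := h1.symm
      _ ≤ _ := by
        refine intervalIntegral.integral_mono_on zero_le_one
          (Continuous.intervalIntegrable (by fun_prop) _ _)
          (Continuous.intervalIntegrable (by fun_prop) _ _) fun t ht => ?_
        have h2 : |t * u| ≤ Real.pi := by
          rw [abs_mul, abs_of_nonneg ht.1]
          exact (mul_le_of_le_one_left (abs_nonneg u) ht.2).trans h
        have h3 := Real.cos_le_one_sub_mul_cos_sq h2
        have h5 : 1 / 5 ≤ 2 / Real.pi ^ 2 := by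
          rw [div_le_div_iff₀ (by norm_num) (by positivity)]
          nlinarith
        nlinarith [mul_le_mul_of_nonneg_right h5 (sq_nonneg (t * u))]
  · have hu : u ≠ 0 := fun h0 => by
      rw [h0, abs_zero] at h
      linarith
    have h1 : ∫ t in (0 : ℝ)..1, (1 - Real.cos (t * u)) = 1 - u⁻¹ * Real.sin u := by
      rw [intervalIntegral.integral_sub (by simp)
        (Continuous.intervalIntegrable (by fun_prop) _ _),
        intervalIntegral.integral_comp_mul_right (fun s => Real.cos s) hu]
      simp
    rw [h1]
    have h2 : |u⁻¹ * Real.sin u| ≤ 3⁻¹ := by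
      rw [abs_mul, abs_inv]
      calc |u|⁻¹ * |Real.sin u| ≤ |u|⁻¹ * 1 := by gcongr; exact Real.abs_sin_le_one u
        _ ≤ 3⁻¹ := by rw [mul_one]; gcongr; linarith
    have h3 := (abs_le.1 h2).2
    have h4 := min_le_left 1 (u ^ 2)
    linarith

lemma min_one_sum_le {ι : Type*} (s : Finset ι) (f : ι → ℝ) (hf : ∀ i, 0 ≤ f i) :
    min 1 (∑ i ∈ s, f i) ≤ ∑ i ∈ s, min 1 (f i) := by
  classical
  induction s using Finset.induction_on with
  | empty => simp
  | insert a s ha ih =>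
    rw [Finset.sum_insert ha, Finset.sum_insert ha]
    refine le_trans ?_ (add_le_add_right ih _)
    have h1 := hf a
    have h2 := Finset.sum_nonneg fun i (_ : i ∈ s) => hf i
    rcases le_total 1 (f a) with h3 | h3 <;> rcases le_total 1 (∑ i ∈ s, f i) with h4 | h4 <;>
      simp only [min_eq_left, min_eq_right, h3, h4] <;>
      first
      | exact (min_le_left _ _).trans (by linarith)
      | exact min_le_right _ _

/-- The one-dimensional bound in each coordinate, summed using subadditivity of `min 1`. It makes
division by `avgOsc` possible off the origin and gives integrability of `min 1 |x|²`. -/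
lemma le_avgOsc (x : E d) : 1 / 15 * min 1 (‖x‖ ^ 2) ≤ avgOsc x := by
  have h1 : ∀ j : Fin d, 1 / 15 * min 1 (x j ^ 2) ≤ ∫ t in (0 : ℝ)..1, osc (t • basisVec j) x := by
    intro j
    refine (min_one_sq_le_integral_one_sub_cos (x j)).trans_eq ?_
    refine intervalIntegral.integral_congr fun t _ => ?_
    simp [osc, basisVec, inner_smul_right, EuclideanSpace.inner_single_right]
  rw [avgOsc, EuclideanSpace.real_norm_sq_eq]
  refine le_trans ?_ (Finset.sum_le_sum fun j _ => h1 j)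
  rw [← Finset.mul_sum]
  gcongr
  exact min_one_sum_le _ _ fun i => sq_nonneg _

lemma avgOsc_pos {x : E d} (hx : x ≠ 0) : 0 < avgOsc x := by
  refine lt_of_lt_of_le ?_ (le_avgOsc x)
  have : 0 < ‖x‖ := norm_pos_iff.2 hx
  positivity

/-- Fubini, applied to `secondDiff_charFun` in each coordinate direction. -/
lemma avgDiff_charFun (m : Measure (E d)) [IsFiniteMeasure m] (z : E d) :
    avgDiff (charFun m) z = charFun (weighted m avgOsc) z := by
  rw [charFun_apply (μ := weighted _ _), integral_weighted m continuous_avgOsc.measurable avgOsc_nonneg,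
    avgDiff]
  have hfin : IsFiniteMeasure (volume.restrict (Set.uIoc (0 : ℝ) 1)) := ⟨by simp [Set.uIoc]⟩
  have hint : ∀ j : Fin d, MeasureTheory.Integrable (uncurry fun (t : ℝ) (x : E d) =>
      (osc (t • basisVec j) x : ℂ) * Complex.exp ((inner ℝ x z : ℝ) * Complex.I))
      ((volume.restrict (Set.uIoc (0 : ℝ) 1)).prod m) := by
    intro j
    refine Integrable.of_bound (Continuous.aestronglyMeasurable ?_) 2 (.of_forall fun p => ?_)
    · unfold osc
      fun_prop
    · rw [uncurry, norm_mul, norm_fourier_kernel, mul_one, Complex.norm_real, Real.norm_eq_abs,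
        abs_of_nonneg (osc_nonneg _ _)]
      exact osc_le_two _ _
  have h1 : ∀ j : Fin d, ∫ t in (0 : ℝ)..1, secondDiff (t • basisVec j) (charFun m) z =
      ∫ x, ((∫ t in (0 : ℝ)..1, osc (t • basisVec j) x : ℝ) : ℂ) *
        Complex.exp ((inner ℝ x z : ℝ) * Complex.I) ∂m := by
    intro j
    have h2 : ∀ t : ℝ, secondDiff (t • basisVec j) (charFun m) z =
        ∫ x, (osc (t • basisVec j) x : ℂ) * Complex.exp ((inner ℝ x z : ℝ) * Complex.I) ∂m := by
      intro t
      rw [secondDiff_charFun, charFun_apply, integral_weighted m (measurable_osc _) (osc_nonneg _)]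
    simp_rw [h2]
    rw [intervalIntegral_integral_swap (hint j)]
    refine integral_congr_ae (.of_forall fun x => ?_)
    simp only
    rw [intervalIntegral.integral_mul_const, intervalIntegral.integral_ofReal]
  simp_rw [h1]
  rw [← integral_finsetSum]
  · refine integral_congr_ae (.of_forall fun x => ?_)
    simp only [avgOsc]
    push_cast
    rw [Finset.sum_mul]
  · intro j _
    refine (hint j).integral_prod_right.congr (.of_forall fun x => ?_)
    simp only [uncurry]
    rw [← intervalIntegral.integral_ofReal, ← intervalIntegral.integral_mul_const,
      intervalIntegral.integral_of_le zero_le_one, Set.uIoc_of_le zero_le_one]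

lemma secondDiff_avgDiff {f : E d → ℂ} (hf : Continuous f) (w z : E d) :
    secondDiff w (avgDiff f) z = avgDiff (secondDiff w f) z := by
  have hi : ∀ (j : Fin d) (y : E d), IntervalIntegrable
      (fun t : ℝ => secondDiff (t • basisVec j) f y) volume 0 1 := fun j y =>
    (continuous_secondDiff_smul hf j y).intervalIntegrable _ _
  rw [secondDiff]
  simp only [avgDiff]
  rw [← Finset.sum_add_distrib, Finset.sum_div, ← Finset.sum_sub_distrib]
  refine Finset.sum_congr rfl fun j _ => ?_
  rw [← intervalIntegral.integral_add (hi j _) (hi j _), ← intervalIntegral.integral_div,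
    ← intervalIntegral.integral_sub (hi j _) (((hi j _).add (hi j _)).div_const 2)]
  refine intervalIntegral.integral_congr fun t _ => ?_
  exact secondDiff_comm w (t • basisVec j) f z

/-! ### The Lévy measure of an infinitely divisible distribution -/

/-- A bound independent of `n`, serving as the dominating function when the limit is taken under the
integral in `avgDiff`. -/
lemma norm_mul_exp_div_sub_one_le (a : ℂ) (n : ℕ) :
    ‖((n : ℂ) + 1) * (Complex.exp (a / ((n : ℂ) + 1)) - 1)‖ ≤ ‖a‖ * Real.exp ‖a‖ := by
  have h := Complex.norm_exp_sub_sum_le_norm_mul_exp (a / ((n : ℂ) + 1)) 1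
  simp only [Finset.range_one, Finset.sum_singleton, pow_zero, Nat.factorial_zero, Nat.cast_one,
    div_one, pow_one] at h
  have hn : ‖(n : ℂ) + 1‖ = (n : ℝ) + 1 := by
    rw [← Nat.cast_add_one, Complex.norm_natCast, Nat.cast_add_one]
  have hle : ‖a / ((n : ℂ) + 1)‖ ≤ ‖a‖ := by
    rw [norm_div, hn]
    exact div_le_self (norm_nonneg _) (by linarith [Nat.cast_nonneg (α := ℝ) n])
  rw [norm_mul]
  calc ‖(n : ℂ) + 1‖ * ‖Complex.exp (a / ((n : ℂ) + 1)) - 1‖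
      ≤ ‖(n : ℂ) + 1‖ * (‖a / ((n : ℂ) + 1)‖ * Real.exp ‖a / ((n : ℂ) + 1)‖) := by gcongr
    _ = ‖a‖ * Real.exp ‖a / ((n : ℂ) + 1)‖ := by
      rw [← mul_assoc, ← norm_mul, mul_div_cancel₀ _ (Nat.cast_add_one_ne_zero n)]
    _ ≤ ‖a‖ * Real.exp ‖a‖ := by gcongr

/-- Difference quotients of `t ↦ exp (t a)` at `0` along `t = 1 / (n + 1)`. -/
lemma tendsto_mul_exp_div_sub_one (a : ℂ) :
    Tendsto (fun n : ℕ => ((n : ℂ) + 1) * (Complex.exp (a / ((n : ℂ) + 1)) - 1)) atTop (𝓝 a) := by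
  have h1 : HasDerivAt (fun t : ℝ => Complex.exp ((t : ℂ) * a)) a 0 := by
    have h2 : HasDerivAt (fun t : ℝ => (t : ℂ) * a) (1 * a) 0 :=
      Complex.ofRealCLM.hasDerivAt.mul_const a
    simpa using h2.cexp
  have h3 := (hasDerivAt_iff_tendsto_slope_zero.1 h1).comp
    (f := fun n : ℕ => 1 / ((n : ℝ) + 1)) (x := atTop)
    (tendsto_nhdsWithin_iff.2 ⟨tendsto_one_div_add_atTop_nhds_zero_nat,
      .of_forall fun n => by
        have : (0 : ℝ) < 1 / ((n : ℝ) + 1) := by positivity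
        exact this.ne'⟩)
  refine h3.congr fun n => ?_
  simp [Complex.real_smul, div_eq_inv_mul]

section Exponent

variable {ψ : E d → ℂ} {ρ : ℕ → Measure (E d)}

lemma charFun_smul_nat (n : ℕ) (m : Measure (E d)) (z : E d) :
    charFun (((n + 1 : ℕ) : NNReal) • m) z = ((n : ℂ) + 1) * charFun m z := by
  simp only [charFun_apply]
  rw [integral_smul_nnreal_measure, NNReal.smul_def, Complex.real_smul]
  push_cast
  rfl

/-- The two functions differ by the constant `n + 1`, which second differences annihilate. -/
lemma secondDiff_charFun_smul (h : ∀ n z, charFun (ρ n) z = Complex.exp (ψ z / ((n : ℂ) + 1)))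
    (n : ℕ) (w z : E d) :
    secondDiff w (charFun (((n + 1 : ℕ) : NNReal) • ρ n)) z =
      secondDiff w (fun z => ((n : ℂ) + 1) * (Complex.exp (ψ z / ((n : ℂ) + 1)) - 1)) z := by
  simp only [secondDiff, charFun_smul_nat, h]
  ring

lemma tendsto_secondDiff (w z : E d) :
    Tendsto (fun n : ℕ => secondDiff w
      (fun z => ((n : ℂ) + 1) * (Complex.exp (ψ z / ((n : ℂ) + 1)) - 1)) z) atTop
      (𝓝 (secondDiff w ψ z)) :=
  (tendsto_mul_exp_div_sub_one _).sub
    (((tendsto_mul_exp_div_sub_one _).add (tendsto_mul_exp_div_sub_one _)).div_const 2)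

lemma exists_charFun_eq_secondDiff [∀ n, IsProbabilityMeasure (ρ n)] (hψ : Continuous ψ)
    (h : ∀ n z, charFun (ρ n) z = Complex.exp (ψ z / ((n : ℂ) + 1))) (w : E d) :
    ∃ G : Measure (E d), IsFiniteMeasure G ∧ ∀ z, charFun G z = secondDiff w ψ z := by
  have hfin : ∀ n : ℕ, IsFiniteMeasure (weighted (((n + 1 : ℕ) : NNReal) • ρ n) (osc w)) :=
    fun n => isFiniteMeasure_weighted (Integrable.of_bound (by fun_prop) 2
      (.of_forall fun x => by
        rw [Real.norm_eq_abs, abs_of_nonneg (osc_nonneg _ _)]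
        exact osc_le_two w x))
  refine exists_finite_charFun_eq (ρ := fun n : ℕ =>
    weighted (((n + 1 : ℕ) : NNReal) • ρ n) (osc w)) (continuous_secondDiff hψ w) fun z => ?_
  simp_rw [← secondDiff_charFun, secondDiff_charFun_smul h]
  exact tendsto_secondDiff w z

lemma exists_charFun_eq_avgDiff [∀ n, IsProbabilityMeasure (ρ n)] (hψ : Continuous ψ)
    (h : ∀ n z, charFun (ρ n) z = Complex.exp (ψ z / ((n : ℂ) + 1))) :
    ∃ G : Measure (E d), IsFiniteMeasure G ∧ ∀ z, charFun G z = avgDiff ψ z := by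
  have hfin : ∀ n : ℕ, IsFiniteMeasure (weighted (((n + 1 : ℕ) : NNReal) • ρ n) avgOsc) :=
    fun n => isFiniteMeasure_weighted (Integrable.of_bound
      continuous_avgOsc.aestronglyMeasurable (2 * d) (.of_forall fun x => by
        rw [Real.norm_eq_abs, abs_of_nonneg (avgOsc_nonneg _)]
        exact avgOsc_le x))
  refine exists_finite_charFun_eq (ρ := fun n : ℕ =>
    weighted (((n + 1 : ℕ) : NNReal) • ρ n) avgOsc) (continuous_avgDiff hψ) fun z => ?_
  simp_rw [← avgDiff_charFun]
  unfold avgDiff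
  refine tendsto_finsetSum _ fun j _ => ?_
  simp_rw [secondDiff_charFun_smul h]
  let b : E d → ℝ := fun z => ‖ψ z‖ * Real.exp ‖ψ z‖
  refine intervalIntegral.tendsto_integral_filter_of_dominated_convergence
    (fun t => b z + (b (z + t • basisVec j) + b (z - t • basisVec j)) / 2)
    (.of_forall fun n => ?_) (.of_forall fun n => .of_forall fun t _ => ?_) ?_
    (.of_forall fun t _ => tendsto_secondDiff _ z)
  · exact (continuous_secondDiff_smul (by fun_prop) j z).aestronglyMeasurable
  · refine (norm_sub_le _ _).trans (add_le_add (norm_mul_exp_div_sub_one_le _ _) ?_)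
    rw [norm_div, Complex.norm_ofNat]
    gcongr
    exact (norm_add_le _ _).trans
      (add_le_add (norm_mul_exp_div_sub_one_le _ _) (norm_mul_exp_div_sub_one_le _ _))
  · exact Continuous.intervalIntegrable (by fun_prop) _ _

/-- Characteristic functions are hermitian, and `ψ` is a pointwise limit of real affine combinations
of those of `ρ n`. -/
lemma exponent_neg (h : ∀ n z, charFun (ρ n) z = Complex.exp (ψ z / ((n : ℂ) + 1))) (z : E d) :
    ψ (-z) = (starRingEnd ℂ) (ψ z) := by
  refine tendsto_nhds_unique (tendsto_mul_exp_div_sub_one (ψ (-z)))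
    (((Complex.continuous_conj.tendsto _).comp (tendsto_mul_exp_div_sub_one (ψ z))).congr
      fun n => ?_)
  rw [← h, charFun_neg, h]
  simp

end Exponent

/-- Lévy measures on `ℝ^d`. -/
structure IsLevyMeasure (m : Measure (E d)) : Prop where
  zero : m {0} = 0
  integrable : MeasureTheory.Integrable (fun x : E d => min (1 : ℝ) (‖x‖ ^ 2)) m

lemma IsLevyMeasure.integrable_osc {m : Measure (E d)} (hm : IsLevyMeasure m) (w : E d) :
    MeasureTheory.Integrable (osc w) m :=
  (hm.integrable.const_mul (2 + ‖w‖ ^ 2)).mono' (measurable_osc w).aestronglyMeasurable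
    (.of_forall fun x => by
      rw [Real.norm_eq_abs, abs_of_nonneg (osc_nonneg _ _)]
      exact osc_le w x)

lemma IsLevyMeasure.isFiniteMeasure_weighted_osc {m : Measure (E d)} (hm : IsLevyMeasure m)
    (w : E d) : IsFiniteMeasure (weighted m (osc w)) :=
  isFiniteMeasure_weighted (hm.integrable_osc w)

/-- The measure with density `1 / avgOsc` with respect to a finite measure, away from the origin,
is a Lévy measure. -/
lemma isLevyMeasure_withDensity_inv (G : Measure (E d)) [IsFiniteMeasure G] :
    IsLevyMeasure ((G.restrict {0}ᶜ).withDensity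
      (fun x => ENNReal.ofReal (avgOsc x))⁻¹) := by
  have hmeas : Measurable fun x : E d => ENNReal.ofReal (avgOsc x) :=
    continuous_avgOsc.measurable.ennreal_ofReal
  constructor
  · apply withDensity_absolutelyContinuous
    rw [Measure.restrict_apply (measurableSet_singleton 0), Set.inter_compl_self, measure_empty]
  · refine ⟨by fun_prop, ?_⟩
    rw [hasFiniteIntegral_iff_ofReal (.of_forall fun x => by positivity),
      lintegral_withDensity_eq_lintegral_mul _ hmeas.inv (by fun_prop)]
    calc _ ≤ ∫⁻ _, ENNReal.ofReal 15 ∂(G.restrict {0}ᶜ) := by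
          refine lintegral_mono fun x => ?_
          simp only [Pi.mul_apply, Pi.inv_apply]
          have h1 : ENNReal.ofReal (min 1 (‖x‖ ^ 2)) ≤
              ENNReal.ofReal (avgOsc x) * ENNReal.ofReal 15 := by
            rw [← ENNReal.ofReal_mul (avgOsc_nonneg x)]
            exact ENNReal.ofReal_le_ofReal (by linarith [le_avgOsc x])
          calc _ ≤ (ENNReal.ofReal (avgOsc x))⁻¹ *
                (ENNReal.ofReal (avgOsc x) * ENNReal.ofReal 15) := by gcongr
            _ ≤ 1 * ENNReal.ofReal 15 := by
              rw [← mul_assoc]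
              gcongr
              exact ENNReal.inv_mul_le_one _
            _ = _ := one_mul _
      _ < ⊤ := by
        rw [lintegral_const]
        exact ENNReal.mul_lt_top ENNReal.ofReal_lt_top (measure_lt_top _ _)

/-- The second differences of the characteristic exponent of an infinitely divisible distribution
are, up to constants, Fourier transforms of its Lévy measure with a density. -/
lemma exists_levyMeasure {ψ : E d → ℂ} (hψ : Continuous ψ) {ρ : ℕ → Measure (E d)}
    [∀ n, IsProbabilityMeasure (ρ n)]
    (h : ∀ n z, charFun (ρ n) z = Complex.exp (ψ z / ((n : ℂ) + 1))) :
    ∃ m : Measure (E d), IsLevyMeasure m ∧ ∃ a : E d → ℝ,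
      ∀ w z, secondDiff w ψ z = a w + charFun (weighted m (osc w)) z := by
  obtain ⟨G, hG, hGψ⟩ := exists_charFun_eq_avgDiff hψ h
  choose K hK hKψ using exists_charFun_eq_secondDiff hψ h
  -- Both sides have the transform obtained by applying `avgDiff` and `secondDiff w` to `ψ`, in
  -- either order.
  have key : ∀ w, weighted (K w) avgOsc = weighted G (osc w) := by
    intro w
    have h1 : IsFiniteMeasure (weighted (K w) avgOsc) := isFiniteMeasure_weighted
      (Integrable.of_bound continuous_avgOsc.aestronglyMeasurable (2 * d) (.of_forall fun x => by
        rw [Real.norm_eq_abs, abs_of_nonneg (avgOsc_nonneg _)]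
        exact avgOsc_le x))
    have h2 : IsFiniteMeasure (weighted G (osc w)) := isFiniteMeasure_weighted
      (Integrable.of_bound (by fun_prop) 2 (.of_forall fun x => by
        rw [Real.norm_eq_abs, abs_of_nonneg (osc_nonneg _ _)]
        exact osc_le_two w x))
    refine Measure.ext_of_charFun (funext fun z => ?_)
    rw [← avgDiff_charFun, ← secondDiff_charFun, funext hGψ, funext (hKψ w),
      secondDiff_avgDiff hψ]
  have hS : MeasurableSet ({0}ᶜ : Set (E d)) := (measurableSet_singleton 0).compl
  have hmeas : Measurable fun x : E d => ENNReal.ofReal (avgOsc x) :=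
    continuous_avgOsc.measurable.ennreal_ofReal
  have hosc : ∀ w : E d, Measurable fun x : E d => ENNReal.ofReal (osc w x) := fun w =>
    (measurable_osc w).ennreal_ofReal
  refine ⟨_, isLevyMeasure_withDensity_inv G, fun w => (K w).real {0}, fun w z => ?_⟩
  -- Exchange the densities, replace `osc w • G` by `avgOsc • K w`, and cancel `avgOsc`, which is
  -- positive off the origin.
  have hw : weighted ((G.restrict {0}ᶜ).withDensity (fun x => ENNReal.ofReal (avgOsc x))⁻¹)
      (osc w) = (K w).restrict {0}ᶜ := by
    rw [weighted, ← withDensity_mul _ hmeas.inv (hosc w), mul_comm,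
      withDensity_mul _ (hosc w) hmeas.inv, ← restrict_withDensity hS]
    change ((weighted G (osc w)).restrict _).withDensity _ = _
    rw [← key, weighted, restrict_withDensity hS]
    refine withDensity_inv_same hmeas ?_ (by simp)
    rw [ae_restrict_iff' hS]
    exact .of_forall fun x hx => by simpa using avgOsc_pos hx
  -- The atom of `K w` at the origin contributes the constant `a w` to the transform.
  rw [hw, ← hKψ, charFun_apply, charFun_apply,
    ← integral_add_compl (measurableSet_singleton 0) (integrable_fourier_kernel (K w) z),
    Measure.restrict_singleton, integral_smul_measure]
  simp [Measure.real]

/-! ### Functional equations -/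

/-- Jensen's equation together with `r 0 = 0` gives additivity after the change of variables `(x ±
y) / 2`; a continuous additive map is linear, and Riesz represents it. -/
lemma exists_inner_eq {r : E d → ℝ} (hr : Continuous r) (h0 : r 0 = 0)
    (h : ∀ z w, r (z + w) + r (z - w) = 2 * r z) : ∃ γ : E d, ∀ z, r z = inner ℝ γ z := by
  have hadd : ∀ x y, r (x + y) = r x + r y := by
    intro x y
    have h1 := h ((1 / 2 : ℝ) • (x + y)) ((1 / 2 : ℝ) • (x - y))
    have h2 := h ((1 / 2 : ℝ) • (x + y)) ((1 / 2 : ℝ) • (x + y))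
    rw [← smul_add, ← smul_sub, show x + y + (x - y) = (2 : ℝ) • x by rw [two_smul]; abel,
      show x + y - (x - y) = (2 : ℝ) • y by rw [two_smul]; abel, smul_smul, smul_smul] at h1
    rw [← smul_add, ← two_smul ℝ, smul_smul, sub_self, h0] at h2
    norm_num at h1 h2
    rw [h2, h1]
  let L : E d →L[ℝ] ℝ := (AddMonoidHom.mk' r hadd).toRealLinearMap hr
  exact ⟨(InnerProductSpace.toDual ℝ (E d)).symm L, fun z => by
    rw [InnerProductSpace.toDual_symm_apply]
    rfl⟩

/-- The Jordan-von Neumann argument: the parallelogram law makes the polarisation `B` biadditive,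
and continuity makes it bilinear. -/
lemma exists_matrix_eq {r : E d → ℝ} (hr : Continuous r)
    (h : ∀ z w, r (z + w) + r (z - w) = 2 * r z + 2 * r w) :
    ∃ A : Matrix (Fin d) (Fin d) ℝ, A.IsSymm ∧
      ∀ z, r z = inner ℝ z (Matrix.toEuclideanLin A z) := by
  have hthree : ∀ x y z, r (x + y + z) + r x + r y + r z = r (x + y) + r (x + z) + r (y + z) := by
    intro x y z
    have h1 := h (x + z) y
    have h2 := h x (z - y)
    have h3 := h (x + y) z
    have h4 := h z y
    rw [show x + z + y = x + y + z by abel, show x + z - y = x + (z - y) by abel] at h1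
    rw [show x - (z - y) = x + y - z by abel] at h2
    rw [add_comm z y] at h4
    linarith
  have h0 : r 0 = 0 := by
    have := h 0 0
    simp only [add_zero, sub_zero] at this
    linarith
  let B : E d → E d → ℝ := fun x y => (r (x + y) - r x - r y) / 2
  have hBsymm : ∀ x y, B x y = B y x := fun x y => by
    simp only [B, add_comm x y]
    ring
  have hBadd : ∀ x x' y, B (x + x') y = B x y + B x' y := fun x x' y => by
    have := hthree x x' y
    simp only [B]
    linarith
  have hBsmul : ∀ (s : ℝ) (x y : E d), B (s • x) y = s * B x y := fun s x y => by
    have hc : Continuous fun x => B x y := by fun_prop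
    exact ((AddMonoidHom.mk' (fun x => B x y) (fun a b => hBadd a b y)).toRealLinearMap hc).map_smul
      s x
  let b : E d →ₗ[ℝ] E d →ₗ[ℝ] ℝ := LinearMap.mk₂ ℝ B hBadd hBsmul
    (fun x y y' => by rw [hBsymm, hBadd, hBsymm y, hBsymm y'])
    (fun s x y => by rw [hBsymm, hBsmul, hBsymm y]; rfl)
  have hdiag : ∀ x, b x x = r x := fun x => by
    have h1 := h x x
    rw [sub_self, h0] at h1
    change (r (x + x) - r x - r x) / 2 = r x
    linarith
  refine ⟨Matrix.of fun i j => b (basisVec i) (basisVec j), ?_, fun z => ?_⟩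
  · ext i j
    exact hBsymm _ _
  · have hz : z = ∑ i, z i • basisVec i := by
      ext j
      simp [basisVec, Pi.single_apply]
    have hbz : ∀ y, b y z = ∑ j, z j * b y (basisVec j) := fun y => by
      conv_lhs => rw [hz, map_sum]
      simp
    have hbz' : ∀ y, b z y = ∑ i, z i * b (basisVec i) y := fun y => by
      conv_lhs => rw [hz, map_sum, LinearMap.sum_apply]
      simp
    rw [← hdiag, hbz', PiLp.inner_apply]
    refine Finset.sum_congr rfl fun i _ => ?_
    rw [hbz]
    simp [Matrix.toLpLin_apply, Matrix.mulVec, dotProduct, mul_comm]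

/-- A continuous hermitian function whose second differences are real constants is of the form
`i⟨γ,z⟩ - ½⟨z,Az⟩`. -/
lemma exists_quadratic_eq {q : E d → ℂ} (hq : Continuous q) (h0 : q 0 = 0)
    (hneg : ∀ z, q (-z) = (starRingEnd ℂ) (q z)) {a : E d → ℝ}
    (h : ∀ w z, secondDiff w q z = a w) :
    ∃ (A : Matrix (Fin d) (Fin d) ℝ) (γ : E d), A.IsSymm ∧
      ∀ z, q z = Complex.I * ((inner ℝ γ z : ℝ) : ℂ) -
        (1 / 2 : ℂ) * ((inner ℝ z (Matrix.toEuclideanLin A z) : ℝ) : ℂ) := by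
  have hre : ∀ w z, (q (z + w)).re + (q (z - w)).re = 2 * (q z).re - 2 * a w := fun w z => by
    have := congrArg Complex.re (h w z)
    simp only [secondDiff, Complex.sub_re, Complex.div_ofNat_re, Complex.add_re,
      Complex.ofReal_re] at this
    linarith
  have him : ∀ z w, (q (z + w)).im + (q (z - w)).im = 2 * (q z).im := fun z w => by
    have := congrArg Complex.im (h w z)
    simp only [secondDiff, Complex.sub_im, Complex.div_ofNat_im, Complex.add_im,
      Complex.ofReal_im] at this
    linarith
  have ha : ∀ w, a w = -(q w).re := fun w => by
    have := hre w 0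
    rw [zero_add, zero_sub, hneg, Complex.conj_re, h0, Complex.zero_re] at this
    linarith
  obtain ⟨γ, hγ⟩ := exists_inner_eq (Complex.continuous_im.comp hq) (by simp [h0]) him
  obtain ⟨A, hA, hAq⟩ := exists_matrix_eq (r := fun z => -2 * (q z).re) (by fun_prop)
    fun z w => by
      have := hre w z
      rw [ha] at this
      linarith
  refine ⟨A, γ, hA, fun z => ?_⟩
  rw [← hγ, ← hAq]
  apply Complex.ext <;> simp

/-! ### The Lévy-Khintchine integral -/

/-- The integrand of the Lévy-Khintchine formula. -/
noncomputable def levyKernel (c : E d → E d) (z x : E d) : ℂ :=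
  Complex.exp (Complex.I * ((inner ℝ z x : ℝ) : ℂ)) - 1 - Complex.I * ((inner ℝ z (c x) : ℝ) : ℂ)

/-- The integral in the Lévy-Khintchine formula. -/
noncomputable def levyInt (c : E d → E d) (m : Measure (E d)) (z : E d) : ℂ :=
  ∫ x, levyKernel c z x ∂m

lemma norm_exp_sub_one_sub_le (u : ℝ) :
    ‖Complex.exp (Complex.I * (u : ℂ)) - 1 - Complex.I * (u : ℂ)‖ ≤ u ^ 2 * Real.exp |u| := by
  have h := Complex.norm_exp_sub_sum_le_norm_mul_exp (Complex.I * (u : ℂ)) 2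
  simpa [Finset.sum_range_succ, sub_sub] using h

/-- Near the origin, replace `c x` by `x` at cost `|z| |x|²` and use the second-order Taylor bound;
away from it the kernel is bounded. The constant is uniform on balls in `z`, as continuity of
`levyInt` requires. The origin is excluded because `c 0` is unconstrained by the limit. -/
lemma IsRepresentationFunction.exists_norm_levyKernel_le {c : E d → E d}
    (hc : IsRepresentationFunction c) : ∃ K : ℝ → ℝ, ∀ R z, ‖z‖ ≤ R → ∀ x ≠ 0,
      ‖levyKernel c z x‖ ≤ K R * min 1 (‖x‖ ^ 2) := by
  obtain ⟨M, hM⟩ := hc.bounded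
  have hM0 : 0 ≤ M := (norm_nonneg _).trans (hM 0)
  obtain ⟨ε, hε, hball⟩ := Metric.mem_nhdsWithin_iff.1
    (hc.tendsto.eventually (gt_mem_nhds one_pos))
  set δ := min ε 1 with hδ
  have hδ0 : 0 < δ := lt_min hε one_pos
  refine ⟨fun R => (2 + R * M) / δ ^ 2 + (R ^ 2 * Real.exp R + R), fun R z hz x hx => ?_⟩
  have hR : 0 ≤ R := (norm_nonneg z).trans hz
  have hx0 : 0 < ‖x‖ := norm_pos_iff.2 hx
  rcases lt_or_ge ‖x‖ δ with hxδ | hxδ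
  · have h1 : ‖c x - x‖ ≤ ‖x‖ ^ 2 := by
      have : x ∈ Metric.ball (0 : E d) ε ∩ {0}ᶜ :=
        ⟨by simpa using hxδ.trans_le (min_le_left _ _), hx⟩
      have h2 : (‖x‖ ^ 2)⁻¹ * ‖c x - x‖ < 1 := hball this
      rw [inv_mul_lt_iff₀ (by positivity), mul_one] at h2
      exact h2.le
    have hx1 : ‖x‖ ≤ 1 := hxδ.le.trans (min_le_right _ _)
    have h2 : |inner ℝ z x| ≤ R * ‖x‖ := (abs_real_inner_le_norm z x).trans (by gcongr)
    have h3 : |inner ℝ z (c x - x)| ≤ R * ‖x‖ ^ 2 :=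
      (abs_real_inner_le_norm z _).trans (by gcongr)
    have h4 : levyKernel c z x = (Complex.exp (Complex.I * ((inner ℝ z x : ℝ) : ℂ)) - 1 -
        Complex.I * ((inner ℝ z x : ℝ) : ℂ)) - Complex.I * ((inner ℝ z (c x - x) : ℝ) : ℂ) := by
      rw [levyKernel, inner_sub_right]
      push_cast
      ring
    rw [h4, min_eq_right (by nlinarith)]
    calc _ ≤ (inner ℝ z x) ^ 2 * Real.exp |inner ℝ z x| + |inner ℝ z (c x - x)| := by
          refine (norm_sub_le _ _).trans (add_le_add (norm_exp_sub_one_sub_le _) ?_)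
          simp
      _ ≤ (R * ‖x‖) ^ 2 * Real.exp R + R * ‖x‖ ^ 2 := by
          refine add_le_add (mul_le_mul ?_ (Real.exp_le_exp.2 (h2.trans ?_)) (Real.exp_nonneg _)
            (by positivity)) h3
          · rw [← sq_abs (inner ℝ z x)]
            gcongr
          · exact mul_le_of_le_one_right hR hx1
      _ = (R ^ 2 * Real.exp R + R) * ‖x‖ ^ 2 := by ring
      _ ≤ _ := by
        gcongr
        exact le_add_of_nonneg_left (by positivity)
  · have h1 : ‖levyKernel c z x‖ ≤ 2 + R * M := by
      rw [levyKernel]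
      refine (norm_sub_le _ _).trans (add_le_add ?_ ?_)
      · refine (norm_sub_le _ _).trans ?_
        rw [mul_comm, Complex.norm_exp_ofReal_mul_I, norm_one]
        norm_num
      · rw [norm_mul, Complex.norm_I, one_mul, Complex.norm_real]
        exact (norm_inner_le_norm z _).trans
          (mul_le_mul hz (hM x) (norm_nonneg _) hR)
    have h2 : δ ^ 2 ≤ min 1 (‖x‖ ^ 2) := by
      refine le_min ?_ (by gcongr)
      exact pow_le_one₀ hδ0.le (min_le_right _ _)
    calc ‖levyKernel c z x‖ ≤ (2 + R * M) / δ ^ 2 * δ ^ 2 := by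
          rwa [div_mul_cancel₀ _ (by positivity)]
      _ ≤ _ := by
        gcongr
        exact le_add_of_nonneg_right (by positivity)

lemma IsRepresentationFunction.measurable_levyKernel {c : E d → E d}
    (hc : IsRepresentationFunction c) (z : E d) : Measurable (levyKernel c z) := by
  have := hc.measurable
  unfold levyKernel
  fun_prop

lemma IsLevyMeasure.ae_ne_zero {m : Measure (E d)} (hm : IsLevyMeasure m) : ∀ᵐ x ∂m, x ≠ 0 := by
  rw [ae_iff]
  simpa using hm.zero

lemma IsLevyMeasure.restrict_compl_zero {m : Measure (E d)} (hm : IsLevyMeasure m) :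
    m.restrict {0}ᶜ = m :=
  Measure.restrict_eq_self_of_ae_mem hm.ae_ne_zero

lemma IsLevyMeasure.integrable_levyKernel {m : Measure (E d)} (hm : IsLevyMeasure m)
    {c : E d → E d} (hc : IsRepresentationFunction c) (z : E d) :
    MeasureTheory.Integrable (levyKernel c z) m := by
  obtain ⟨K, hK⟩ := hc.exists_norm_levyKernel_le
  refine (hm.integrable.const_mul (K ‖z‖)).mono' (hc.measurable_levyKernel z).aestronglyMeasurable ?_
  filter_upwards [hm.ae_ne_zero] with x hx using hK _ z le_rfl x hx

lemma IsLevyMeasure.continuous_levyInt {m : Measure (E d)} (hm : IsLevyMeasure m)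
    {c : E d → E d} (hc : IsRepresentationFunction c) : Continuous (levyInt c m) := by
  obtain ⟨K, hK⟩ := hc.exists_norm_levyKernel_le
  refine continuous_iff_continuousAt.2 fun z₀ => ?_
  unfold levyInt
  refine continuousAt_of_dominated (bound := fun x => K (‖z₀‖ + 1) * min 1 (‖x‖ ^ 2))
    (.of_forall fun z => (hc.measurable_levyKernel z).aestronglyMeasurable) ?_
    (hm.integrable.const_mul _) (.of_forall fun x => ?_)
  · filter_upwards [Metric.ball_mem_nhds z₀ one_pos] with z hz
    filter_upwards [hm.ae_ne_zero] with x hx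
    refine hK _ z ?_ x hx
    have h1 := norm_sub_norm_le z z₀
    rw [Metric.mem_ball, dist_eq_norm] at hz
    linarith
  · unfold levyKernel
    fun_prop

lemma levyInt_zero (c : E d → E d) (m : Measure (E d)) : levyInt c m 0 = 0 := by
  simp [levyInt, levyKernel]

lemma levyInt_neg (c : E d → E d) (m : Measure (E d)) (z : E d) :
    levyInt c m (-z) = (starRingEnd ℂ) (levyInt c m z) := by
  rw [levyInt, levyInt, ← integral_conj]
  refine integral_congr_ae (.of_forall fun x => ?_)
  simp [levyKernel, ← Complex.exp_conj]

/-- The compensating terms `1` and `⟨z, c x⟩` are affine in `z`, so second differences remove them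
and with them the dependence on `c`. -/
lemma IsLevyMeasure.secondDiff_levyInt {m : Measure (E d)} (hm : IsLevyMeasure m)
    {c : E d → E d} (hc : IsRepresentationFunction c) (w z : E d) :
    secondDiff w (levyInt c m) z = charFun (weighted m (osc w)) z := by
  have hi := hm.integrable_levyKernel hc
  have hi' : MeasureTheory.Integrable
      (fun x => (levyKernel c (z + w) x + levyKernel c (z - w) x) / 2) m :=
    ((hi _).add (hi _)).div_const 2
  rw [charFun_apply (μ := weighted _ _), integral_weighted m (measurable_osc w) (osc_nonneg w),
    secondDiff]
  unfold levyInt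
  rw [← integral_add (hi _) (hi _), ← integral_div, ← integral_sub (hi _) hi']
  refine integral_congr_ae (.of_forall fun x => ?_)
  simp only
  rw [← fourier_kernel_secondDiff]
  simp only [levyKernel, inner_add_left, inner_sub_left, real_inner_comm, inner_add_right,
    inner_sub_right, mul_comm Complex.I]
  push_cast
  ring

/-- The **Lévy-Khintchine formula** for infinitely divisible distributions. -/
lemma IsInfinitelyDivisible.exists_levyKhintchine {μ : Measure (E d)}
    (h : IsInfinitelyDivisible μ) {c : E d → E d} (hc : IsRepresentationFunction c) :
    ∃ (A : Matrix (Fin d) (Fin d) ℝ) (m : Measure (E d)) (γ : E d), A.IsSymm ∧ IsLevyMeasure m ∧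
      ∀ z, charFun μ z = Complex.exp (Complex.I * ((inner ℝ γ z : ℝ) : ℂ) -
        (1 / 2 : ℂ) * ((inner ℝ z (Matrix.toEuclideanLin A z) : ℝ) : ℂ) + levyInt c m z) := by
  obtain ⟨ψ, hψ, hψ0, hμ, hρ⟩ := h.exists_exponent
  choose ρ hρ hρψ using hρ
  obtain ⟨m, hm, a, ha⟩ := exists_levyMeasure hψ hρψ
  obtain ⟨A, γ, hA, hq⟩ := exists_quadratic_eq (q := fun z => ψ z - levyInt c m z)
    (hψ.sub (hm.continuous_levyInt hc)) (by simp [hψ0, levyInt_zero])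
    (fun z => by rw [exponent_neg hρψ, levyInt_neg, map_sub])
    (fun w z => by rw [secondDiff_sub, ha, hm.secondDiff_levyInt hc, add_sub_cancel_right])
  exact ⟨A, m, γ, hA, hm, fun z => by rw [hμ, ← hq, sub_add_cancel]⟩

/-! ### Quasi-Lévy type measures and Lévy measures -/

lemma IsLevyMeasure.lt_top {m : Measure (E d)} (hm : IsLevyMeasure m) {B : Set (E d)}
    (hB : B ∈ B0 d) : m B < ⊤ := by
  obtain ⟨r, hr, -, hBr⟩ := hB
  refine lt_of_le_of_lt (measure_mono fun x hx => ?_)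
    (hm.integrable.measure_ge_lt_top (ε := min 1 (r ^ 2)) (by positivity))
  have h1 : r ≤ ‖x‖ := hBr hx
  simp only [Set.mem_ofPred_eq]
  gcongr

lemma measure_le_of_le_on_B0 {m₁ m₂ : Measure (E d)} (h1 : m₁ {0} = 0)
    (h : ∀ B ∈ B0 d, m₁ B ≤ m₂ B) : m₁ ≤ m₂ := by
  have hdisj : ∀ B : Set (E d), Pairwise (Disjoint on fun n => B ∩ LocalSignedMeasure.annulus d n) :=
    fun B i j hij => LocalSignedMeasure.disjoint_annulus hij B
  refine Measure.le_iff.2 fun B hB => ?_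
  have hmeas := fun n => hB.inter (LocalSignedMeasure.measurableSet_annulus (d := d) n)
  calc m₁ B = m₁ (⋃ n, B ∩ LocalSignedMeasure.annulus d n) := by
        rw [← Set.inter_iUnion, LocalSignedMeasure.iUnion_annulus, ← Set.sdiff_eq,
          measure_sdiff_null h1]
    _ = ∑' n, m₁ (B ∩ LocalSignedMeasure.annulus d n) := measure_iUnion (hdisj B) hmeas
    _ ≤ ∑' n, m₂ (B ∩ LocalSignedMeasure.annulus d n) :=
        ENNReal.tsum_le_tsum fun n => h _ ⟨1 / ((n : ℝ) + 1), by positivity, hmeas n,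
          Set.inter_subset_right.trans (LocalSignedMeasure.annulus_subset n)⟩
    _ = m₂ (⋃ n, B ∩ LocalSignedMeasure.annulus d n) := (measure_iUnion (hdisj B) hmeas).symm
    _ ≤ m₂ B := measure_mono (Set.iUnion_subset fun n => Set.inter_subset_left)

namespace LocalSignedMeasure

lemma toFun_eq_sub (ν : LocalSignedMeasure d) (B : B0 d) :
    ν.toFun B = ν.posPart.real B - ν.negPart.real B := by
  obtain ⟨B, r, hr, hB⟩ := B
  rw [← ν.restr_apply hr hB, SignedMeasure.apply_eq_posPart_real_sub_negPart_real _ hB.1,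
    Measure.real, Measure.real, Measure.real, Measure.real, ν.posPart_apply hr hB,
    ν.negPart_apply hr hB]

lemma IsQuasiLevyType.isLevyMeasure_posPart {ν : LocalSignedMeasure d} (h : ν.IsQuasiLevyType) :
    IsLevyMeasure ν.posPart :=
  ⟨ν.posPart_zero, MeasureTheory.Integrable.mono_measure h (Measure.le_add_right le_rfl)⟩

lemma IsQuasiLevyType.isLevyMeasure_negPart {ν : LocalSignedMeasure d} (h : ν.IsQuasiLevyType) :
    IsLevyMeasure ν.negPart :=
  ⟨ν.negPart_zero, MeasureTheory.Integrable.mono_measure h (Measure.le_add_left le_rfl)⟩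

/-- The difference of two Lévy measures. -/
noncomputable def ofLevy {m₁ m₂ : Measure (E d)} (h₁ : IsLevyMeasure m₁) (h₂ : IsLevyMeasure m₂) :
    LocalSignedMeasure d where
  toFun B := m₁.real B - m₂.real B
  empty := by simp
  iUnion r hr f hf hd := by
    have key : ∀ m : Measure (E d), IsLevyMeasure m →
        HasSum (fun i => m.real (f i)) (m.real (⋃ i, f i)) := by
      intro m hm
      have h1 := measure_iUnion (μ := m) hd fun i => (hf i).1
      have h2 : ∑' i, m (f i) ≠ ⊤ := by
        rw [← h1]
        exact (hm.lt_top (iUnion_mem_B0 hr hf)).ne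
      rw [Measure.real, h1]
      have h3 := ENNReal.hasSum_toReal h2
      rwa [← ENNReal.tsum_toReal_eq (fun i => (hm.lt_top ⟨r, hr, hf i⟩).ne)] at h3
    exact (key m₁ h₁).sub (key m₂ h₂)

section ofLevy

variable {m₁ m₂ : Measure (E d)} (h₁ : IsLevyMeasure m₁) (h₂ : IsLevyMeasure m₂)

lemma ofLevy_apply (B : B0 d) : (ofLevy h₁ h₂).toFun B = m₁.real B - m₂.real B := rfl

lemma restr_ofLevy_apply {r : ℝ} (hr : 0 < r) {B : Set (E d)} (hB : B ∈ Br d r) :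
    (ofLevy h₁ h₂).restr hr B = m₁.real B - m₂.real B :=
  restr_apply _ hr hB

/-- On a Hahn set `i` the positive part is `m₁ (i ∩ B) - m₂ (i ∩ B)`, which is at most `m₁ B`. This
yields the integrability of the parts of a difference. -/
lemma posPart_ofLevy_le : (ofLevy h₁ h₂).posPart ≤ m₁ := by
  refine measure_le_of_le_on_B0 (posPart_zero _) fun B hB => ?_
  obtain ⟨r, hr, hBr⟩ := id hB
  rw [posPart_apply _ hr hBr]
  obtain ⟨i, hi, hi₂, hi₃, hp, -⟩ :=
    ((ofLevy h₁ h₂).restr hr).toJordanDecomposition_spec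
  rw [hp, SignedMeasure.toMeasureOfZeroLE_apply _ _ _ hBr.1]
  have hsub : i ∩ B ∈ Br d r := ⟨hi.inter hBr.1, Set.inter_subset_right.trans hBr.2⟩
  have hle : (ofLevy h₁ h₂).restr hr (i ∩ B) ≤ m₁.real B := by
    rw [restr_ofLevy_apply h₁ h₂ hr hsub]
    have h3 : m₁.real (i ∩ B) ≤ m₁.real B :=
      measureReal_mono Set.inter_subset_right (h₁.lt_top hB).ne
    linarith [measureReal_nonneg (μ := m₂) (s := i ∩ B)]
  rw [← ENNReal.ofReal_toReal (h₁.lt_top hB).ne, ENNReal.ofReal, ENNReal.coe_le_coe,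
    ← NNReal.coe_le_coe]
  exact hle.trans (Real.le_coe_toNNReal _)

lemma negPart_ofLevy_le : (ofLevy h₁ h₂).negPart ≤ m₂ := by
  refine measure_le_of_le_on_B0 (negPart_zero _) fun B hB => ?_
  obtain ⟨r, hr, hBr⟩ := id hB
  rw [negPart_apply _ hr hBr]
  obtain ⟨i, hi, hi₂, hi₃, -, hn⟩ :=
    ((ofLevy h₁ h₂).restr hr).toJordanDecomposition_spec
  rw [hn, SignedMeasure.toMeasureOfLEZero_apply _ _ _ hBr.1]
  have hsub : iᶜ ∩ B ∈ Br d r := ⟨hi.compl.inter hBr.1, Set.inter_subset_right.trans hBr.2⟩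
  have hle : -(ofLevy h₁ h₂).restr hr (iᶜ ∩ B) ≤ m₂.real B := by
    rw [restr_ofLevy_apply h₁ h₂ hr hsub]
    have h3 : m₂.real (iᶜ ∩ B) ≤ m₂.real B :=
      measureReal_mono Set.inter_subset_right (h₂.lt_top hB).ne
    linarith [measureReal_nonneg (μ := m₁) (s := iᶜ ∩ B)]
  rw [← ENNReal.ofReal_toReal (h₂.lt_top hB).ne, ENNReal.ofReal, ENNReal.coe_le_coe,
    ← NNReal.coe_le_coe]
  exact hle.trans (Real.le_coe_toNNReal _)

lemma isQuasiLevyType_ofLevy : (ofLevy h₁ h₂).IsQuasiLevyType :=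
  (h₁.integrable.mono_measure (posPart_ofLevy_le h₁ h₂)).add_measure
    (h₂.integrable.mono_measure (negPart_ofLevy_le h₁ h₂))

/-- Since `m₁` and `m₂` need not be mutually singular, they need not be the Jordan parts. Moving
terms across gives an identity of measures that holds also where all masses are infinite. -/
lemma posPart_ofLevy_add : (ofLevy h₁ h₂).posPart + m₂ = (ofLevy h₁ h₂).negPart + m₁ := by
  have hp := (isQuasiLevyType_ofLevy h₁ h₂).isLevyMeasure_posPart
  have hn := (isQuasiLevyType_ofLevy h₁ h₂).isLevyMeasure_negPart
  refine measure_eq_of_eq_on_B0 (by simp [hp.zero, h₂.zero]) (by simp [hn.zero, h₁.zero])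
    fun B hB => ?_
  have h := (toFun_eq_sub (ofLevy h₁ h₂) ⟨B, hB⟩).symm.trans (ofLevy_apply h₁ h₂ ⟨B, hB⟩)
  rw [Measure.add_apply, Measure.add_apply,
    ← ENNReal.toReal_eq_toReal_iff' (ENNReal.add_lt_top.2 ⟨hp.lt_top hB, h₂.lt_top hB⟩).ne
      (ENNReal.add_lt_top.2 ⟨hn.lt_top hB, h₁.lt_top hB⟩).ne,
    ENNReal.toReal_add (hp.lt_top hB).ne (h₂.lt_top hB).ne,
    ENNReal.toReal_add (hn.lt_top hB).ne (h₁.lt_top hB).ne]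
  simp only [Measure.real] at h
  linarith

lemma integral_ofLevy {f : E d → ℂ} (hf₁ : MeasureTheory.Integrable f m₁)
    (hf₂ : MeasureTheory.Integrable f m₂) :
    (ofLevy h₁ h₂).integral f = ∫ x, f x ∂m₁ - ∫ x, f x ∂m₂ := by
  have h := congrArg (fun m => ∫ x, f x ∂m) (posPart_ofLevy_add h₁ h₂)
  beta_reduce at h
  rw [integral_add_measure (hf₁.mono_measure (posPart_ofLevy_le h₁ h₂)) hf₂,
    integral_add_measure (hf₂.mono_measure (negPart_ofLevy_le h₁ h₂)) hf₁] at h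
  rw [integral]
  linear_combination h

end ofLevy

end LocalSignedMeasure

/-! ### Existence of infinitely divisible distributions -/

/-- Compound Poisson distributions. -/
lemma exists_compoundPoisson (m : Measure (E d)) [IsFiniteMeasure m] :
    ∃ ρ : Measure (E d), IsProbabilityMeasure ρ ∧
      ∀ z, charFun ρ z = Complex.exp (charFun m z - m.real Set.univ) := by
  set M := m.real Set.univ with hM
  have hM0 : 0 ≤ M := measureReal_nonneg
  obtain ⟨N, hN⟩ := exists_nat_ge M
  -- `N ≥ M` keeps the weight `1 - M / k n` nonnegative, and the `1` keeps `k n` positive.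
  let k : ℕ → ℕ := fun n => n + N + 1
  have hk0 : ∀ n, (0 : ℝ) < k n := fun n => by simp only [k]; positivity
  have hkM : ∀ n, 0 ≤ 1 - M / k n := fun n => by
    rw [sub_nonneg, div_le_one (hk0 n)]
    simp only [k]
    push_cast
    linarith [Nat.cast_nonneg (α := ℝ) n]
  -- Chosen so that the `k n`-fold convolution has transform `(1 + (charFun m z - M) / k n) ^ k n`,
  -- which tends to the required exponential.
  let s : ℕ → Measure (E d) := fun n =>
    (1 - M / k n).toNNReal • Measure.dirac 0 + (1 / (k n : ℝ)).toNNReal • m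
  have hs : ∀ n, IsProbabilityMeasure (s n) := fun n => by
    constructor
    have h1 : (s n).real Set.univ = 1 := by
      rw [measureReal_add_apply, measureReal_nnreal_smul_apply, measureReal_nnreal_smul_apply,
        Real.coe_toNNReal _ (hkM n), Real.coe_toNNReal _ (by have := hk0 n; positivity), ← hM]
      simp
      field_simp
      ring
    rwa [Measure.real, ENNReal.toReal_eq_one_iff] at h1
  have hsc : ∀ n z, charFun (s n) z = 1 + (charFun m z - M) / (k n : ℂ) := fun n z => by
    simp only [charFun_apply, s]
    rw [integral_add_measure, integral_smul_nnreal_measure, integral_smul_nnreal_measure,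
      NNReal.smul_def, NNReal.smul_def,
      Real.coe_toNNReal _ (hkM n), Real.coe_toNNReal _ (by have := hk0 n; positivity)]
    · simp
      ring
    · exact integrable_fourier_kernel _ z
    · exact integrable_fourier_kernel _ z
  have hp : ∀ n, IsProbabilityMeasure (convPow (s n) (k n)) := fun n =>
    isProbabilityMeasure_convPow _ _
  refine exists_probability_charFun_eq (ρ := fun n => convPow (s n) (k n)) ?_ fun z => ?_
  · have : Continuous (charFun m) := continuous_charFun
    fun_prop
  · simp_rw [charFun_convPow, hsc]
    exact (Complex.tendsto_one_add_div_pow_exp _).comp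
      (tendsto_add_atTop_nat (N + 1))

lemma IsLevyMeasure.isFiniteMeasure_restrict {m : Measure (E d)} (hm : IsLevyMeasure m) {r : ℝ}
    (hr : 0 < r) : IsFiniteMeasure (m.restrict (outer d r)) :=
  ⟨by
    rw [Measure.restrict_apply_univ]
    exact hm.lt_top ⟨r, hr, measurableSet_outer d r, le_rfl⟩⟩

/-- For finite `m` the compensator integrates separately, so it is just a translation of the
compound Poisson law by `-∫ c dm`. -/
lemma exists_probability_of_finite (m : Measure (E d)) [IsFiniteMeasure m] {c : E d → E d}
    (hc : IsRepresentationFunction c) : ∃ ρ : Measure (E d), IsProbabilityMeasure ρ ∧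
      ∀ z, charFun ρ z = Complex.exp (levyInt c m z) := by
  obtain ⟨C, hC⟩ := hc.bounded
  have hci : MeasureTheory.Integrable c m :=
    Integrable.of_bound hc.measurable.aestronglyMeasurable C (.of_forall hC)
  obtain ⟨ρ, hρ, hρm⟩ := exists_compoundPoisson m
  refine ⟨ρ.conv (Measure.dirac (-∫ x, c x ∂m)), inferInstance, fun z => ?_⟩
  rw [charFun_conv, hρm, charFun_dirac, ← Complex.exp_add]
  congr 1
  have h1 : MeasureTheory.Integrable
      (fun x => Complex.exp (Complex.I * ((inner ℝ z x : ℝ) : ℂ))) m := by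
    simpa only [mul_comm Complex.I, real_inner_comm] using integrable_fourier_kernel m z
  have h2 : MeasureTheory.Integrable (fun x => Complex.I * ((inner ℝ z (c x) : ℝ) : ℂ)) m :=
    ((hci.const_inner z).ofReal).const_mul _
  have h3 : levyInt c m z = ∫ x, Complex.exp (Complex.I * ((inner ℝ z x : ℝ) : ℂ)) ∂m -
      ∫ _, (1 : ℂ) ∂m - ∫ x, Complex.I * ((inner ℝ z (c x) : ℝ) : ℂ) ∂m := by
    rw [← integral_sub h1 (integrable_const _), ← integral_sub ?_ h2]
    · rfl
    · exact h1.sub (integrable_const _)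
  rw [h3, integral_const_mul, integral_complex_ofReal, integral_inner hci, charFun_apply]
  simp only [mul_comm Complex.I, real_inner_comm, inner_neg_left, integral_const]
  simp
  ring

lemma iUnion_outer : (⋃ n : ℕ, outer d (1 / ((n : ℝ) + 1))) = {(0 : E d)}ᶜ := by
  rw [← LocalSignedMeasure.iUnion_annulus, LocalSignedMeasure.annulus, iUnion_disjointed]

/-- Truncate `m` away from the origin, where it is finite, and pass to the limit by Lévy's theorem;
`continuous_levyInt` supplies the continuity. -/
lemma IsLevyMeasure.exists_probability {m : Measure (E d)} (hm : IsLevyMeasure m) {c : E d → E d}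
    (hc : IsRepresentationFunction c) : ∃ ρ : Measure (E d), IsProbabilityMeasure ρ ∧
      ∀ z, charFun ρ z = Complex.exp (levyInt c m z) := by
  have hfin : ∀ n : ℕ, IsFiniteMeasure (m.restrict (outer d (1 / ((n : ℝ) + 1)))) := fun n =>
    hm.isFiniteMeasure_restrict (by positivity)
  choose ρ hρ hρm using fun n : ℕ =>
    exists_probability_of_finite (m.restrict (outer d (1 / ((n : ℝ) + 1)))) hc
  refine exists_probability_charFun_eq (ρ := ρ) ?_ fun z => ?_
  · have := hm.continuous_levyInt hc
    fun_prop
  · simp_rw [hρm]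
    refine (Complex.continuous_exp.tendsto _).comp ?_
    have h1 := tendsto_setIntegral_of_monotone (μ := m) (f := levyKernel c z)
      (s := fun n : ℕ => outer d (1 / ((n : ℝ) + 1))) (fun n => measurableSet_outer d _)
      (fun i j hij => outer_mono d (one_div_le_one_div_of_le (by positivity)
        (by exact_mod_cast Nat.succ_le_succ hij)))
      (hm.integrable_levyKernel hc z).integrableOn
    rw [iUnion_outer, hm.restrict_compl_zero] at h1
    exact h1

/-- Gaussian distributions. -/
lemma exists_gaussian {S : Matrix (Fin d) (Fin d) ℝ} (hS : S.IsSymm) :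
    ∃ ρ : Measure (E d), IsProbabilityMeasure ρ ∧ ∀ z, charFun ρ z =
      Complex.exp (-(1 / 2 : ℂ) * ((inner ℝ z (Matrix.toEuclideanLin (S * S) z) : ℝ) : ℂ)) := by
  -- The image of a standard Gaussian under the symmetric map `S` has covariance `S * S`.
  let T : E d →L[ℝ] E d := (Matrix.toEuclideanLin S).toContinuousLinearMap
  have hsymm : ∀ x y, inner ℝ (T x) y = inner ℝ x (T y) :=
    Matrix.isSymmetric_toEuclideanLin_iff.2
      (by rwa [Matrix.IsHermitian, Matrix.conjTranspose_eq_transpose_of_trivial])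
  refine ⟨(ProbabilityTheory.stdGaussian (E d)).map T,
    Measure.isProbabilityMeasure_map (by fun_prop), fun z => ?_⟩
  rw [charFun_apply, integral_map (by fun_prop) (by fun_prop)]
  simp_rw [hsymm]
  rw [← charFun_apply, ProbabilityTheory.charFun_stdGaussian]
  have h1 : Matrix.toEuclideanLin (S * S) z = T (T z) := by
    simp [T, Matrix.toLpLin_apply, Matrix.mulVec_mulVec]
  rw [h1, ← hsymm, real_inner_self_eq_norm_sq]
  congr 1
  push_cast
  ring

lemma IsLevyMeasure.exists_levyKhintchine {m : Measure (E d)} (hm : IsLevyMeasure m)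
    {c : E d → E d} (hc : IsRepresentationFunction c) {S : Matrix (Fin d) (Fin d) ℝ}
    (hS : S.IsSymm) (γ : E d) : ∃ ρ : Measure (E d), IsProbabilityMeasure ρ ∧
      ∀ z, charFun ρ z = Complex.exp (Complex.I * ((inner ℝ γ z : ℝ) : ℂ) -
        (1 / 2 : ℂ) * ((inner ℝ z (Matrix.toEuclideanLin (S * S) z) : ℝ) : ℂ) +
          levyInt c m z) := by
  obtain ⟨ρ₁, h₁, hρ₁⟩ := hm.exists_probability hc
  obtain ⟨ρ₂, h₂, hρ₂⟩ := exists_gaussian hS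
  refine ⟨(Measure.dirac γ).conv (ρ₂.conv ρ₁), inferInstance, fun z => ?_⟩
  rw [charFun_conv, charFun_conv, charFun_dirac, hρ₁, hρ₂, ← Complex.exp_add, ← Complex.exp_add]
  congr 1
  ring

/-- The existence of an infinitely divisible distribution with a given Lévy triplet. -/
lemma IsLevyMeasure.exists_infinitelyDivisible {m : Measure (E d)} (hm : IsLevyMeasure m)
    {c : E d → E d} (hc : IsRepresentationFunction c) {S : Matrix (Fin d) (Fin d) ℝ}
    (hS : S.IsSymm) (γ : E d) : ∃ ρ : Measure (E d), IsInfinitelyDivisible ρ ∧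
      ∀ z, charFun ρ z = Complex.exp (Complex.I * ((inner ℝ γ z : ℝ) : ℂ) -
        (1 / 2 : ℂ) * ((inner ℝ z (Matrix.toEuclideanLin (S * S) z) : ℝ) : ℂ) +
          levyInt c m z) := by
  obtain ⟨μ, hμ, hμz⟩ := hm.exists_levyKhintchine hc hS γ
  refine ⟨μ, ⟨hμ, fun n hn => ?_⟩, hμz⟩
  have hn0 : (0 : ℝ) < n := by exact_mod_cast hn
  have hm' : IsLevyMeasure ((n : NNReal)⁻¹ • m) :=
    ⟨by simp [hm.zero], hm.integrable.smul_measure_nnreal⟩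
  -- The `n`-th root has its triplet divided by `n`; the covariance is `S * S`, so `S` itself is
  -- divided by `√n`.
  obtain ⟨ρ, hρ, hρz⟩ := hm'.exists_levyKhintchine hc (S := (√n)⁻¹ • S) (hS.smul _)
    ((n : ℝ)⁻¹ • γ)
  refine ⟨ρ, hρ, ?_⟩
  have hconv := isProbabilityMeasure_convPow ρ n
  refine Measure.ext_of_charFun (funext fun z => ?_)
  rw [charFun_convPow, hρz, hμz, ← Complex.exp_nat_mul]
  congr 1
  have h1 : ((√n)⁻¹ • S) * ((√n)⁻¹ • S) = (n : ℝ)⁻¹ • (S * S) := by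
    rw [Matrix.smul_mul, Matrix.mul_smul, smul_smul, ← mul_inv, Real.mul_self_sqrt hn0.le]
  have h2 : levyInt c ((n : NNReal)⁻¹ • m) z = (n : ℂ)⁻¹ * levyInt c m z := by
    rw [levyInt, integral_smul_nnreal_measure, NNReal.smul_def, Complex.real_smul]
    simp [levyInt]
  have hnc : (n : ℂ) ≠ 0 := by exact_mod_cast hn0.ne'
  rw [h1, h2, map_smul, LinearMap.smul_apply, inner_smul_right, real_inner_smul_left]
  push_cast
  field_simp

/-! ### Uniqueness of the triplet -/

lemma secondDiff_add (w : E d) (f g : E d → ℂ) (z : E d) :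
    secondDiff w (fun z => f z + g z) z = secondDiff w f z + secondDiff w g z := by
  simp only [secondDiff]
  ring

lemma secondDiff_quadratic (A : Matrix (Fin d) (Fin d) ℝ) (γ w z : E d) :
    secondDiff w (fun z => Complex.I * ((inner ℝ γ z : ℝ) : ℂ) -
      (1 / 2 : ℂ) * ((inner ℝ z (Matrix.toEuclideanLin A z) : ℝ) : ℂ)) z =
      (((1 / 2 : ℝ) * inner ℝ w (Matrix.toEuclideanLin A w) : ℝ) : ℂ) := by
  simp only [secondDiff, map_add, map_sub, inner_add_left, inner_add_right, inner_sub_left,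
    inner_sub_right]
  push_cast
  ring

lemma weighted_osc_zero (m : Measure (E d)) (w : E d) : weighted m (osc w) {0} = 0 := by
  rw [weighted, withDensity_apply _ (measurableSet_singleton 0), Measure.restrict_singleton,
    lintegral_smul_measure, lintegral_dirac]
  simp [osc_zero_right]

/-- The constant `a` is the transform of a point mass at the origin, where neither weighted measure
has an atom. -/
lemma eq_zero_of_charFun_weighted_osc {m₁ m₂ : Measure (E d)} (h₁ : IsLevyMeasure m₁)
    (h₂ : IsLevyMeasure m₂) (w : E d) {a : ℝ}
    (h : ∀ z, a + charFun (weighted m₁ (osc w)) z = charFun (weighted m₂ (osc w)) z) :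
    a = 0 ∧ weighted m₁ (osc w) = weighted m₂ (osc w) := by
  have hf₁ := h₁.isFiniteMeasure_weighted_osc w
  have hf₂ := h₂.isFiniteMeasure_weighted_osc w
  have hadd : ∀ (p : NNReal) (m : Measure (E d)) [IsFiniteMeasure m] (z : E d),
      charFun (p • Measure.dirac 0 + m) z = p + charFun m z := fun p m _ z => by
    simp only [charFun_apply]
    rw [integral_add_measure (integrable_fourier_kernel _ z) (integrable_fourier_kernel _ z),
      integral_smul_nnreal_measure, NNReal.smul_def]
    simp
  -- As `a` may have either sign, its positive and negative parts go on opposite sides to keep both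
  -- sides measures.
  have key : a.toNNReal • Measure.dirac 0 + weighted m₁ (osc w) =
      (-a).toNNReal • Measure.dirac 0 + weighted m₂ (osc w) := by
    refine Measure.ext_of_charFun (funext fun z => ?_)
    rw [hadd, hadd, ← h, ← add_assoc, Real.coe_toNNReal', Real.coe_toNNReal']
    congr 1
    norm_cast
    have h3 := max_zero_sub_eq_self a
    rw [max_comm a 0, max_comm (-a) 0] at *
    linarith
  have ha : a = 0 := by
    have h3 := congrArg (fun m => m {0}) key
    simp only [Measure.add_apply, weighted_osc_zero, Measure.smul_apply] at h3
    simp only [Measure.dirac_apply_of_mem (Set.mem_singleton (0 : E d)), add_zero,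
      ENNReal.smul_def, smul_eq_mul, mul_one, ENNReal.coe_inj] at h3
    have h4 := congrArg NNReal.toReal h3
    rw [Real.coe_toNNReal', Real.coe_toNNReal'] at h4
    have h5 := max_zero_sub_eq_self a
    rw [h4] at h5
    linarith
  refine ⟨ha, ?_⟩
  simpa [ha] using key

/-- If `x j ≠ 0`, a step `1 / (n + 1)` with `n > |x j|` puts the angle strictly within `2π`, where
the cosine is not `1`. Countability of the cover is what allows measures to be compared piece by
piece. -/
lemma iUnion_osc_ne_zero :
    (⋃ p : ℕ × Fin d, {x : E d | osc ((1 / ((p.1 : ℝ) + 1)) • basisVec p.2) x ≠ 0}) = {0}ᶜ := by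
  ext x
  simp only [Set.mem_iUnion, Set.mem_ofPred_eq, Set.mem_compl_iff, Set.mem_singleton_iff]
  constructor
  · rintro ⟨p, hp⟩ rfl
    exact hp (osc_zero_right _)
  · intro hx
    obtain ⟨j, hj⟩ : ∃ j, x j ≠ 0 := by
      by_contra! hall
      exact hx (by ext j; simpa using hall j)
    obtain ⟨n, hn⟩ := exists_nat_gt |x j|
    refine ⟨(n, j), fun h0 => hj ?_⟩
    have hn0 : (0 : ℝ) < (n : ℝ) + 1 := by positivity
    have hpi := Real.pi_gt_three
    have h1 : |1 / ((n : ℝ) + 1) * x j| < 2 * Real.pi := by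
      rw [abs_mul, abs_of_pos (by positivity : (0 : ℝ) < 1 / ((n : ℝ) + 1)), one_div,
        inv_mul_lt_iff₀ hn0]
      nlinarith [abs_nonneg (x j)]
    have h2 : Real.cos (1 / ((n : ℝ) + 1) * x j) = 1 := by
      have h3 : inner ℝ x ((1 / ((n : ℝ) + 1)) • basisVec j) = 1 / ((n : ℝ) + 1) * x j := by
        simp [basisVec, inner_smul_right, EuclideanSpace.inner_single_right]
      rw [osc, h3] at h0
      linarith
    rw [Real.cos_eq_one_iff_of_lt_of_lt (abs_lt.1 h1).1 (abs_lt.1 h1).2] at h2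
    exact (mul_eq_zero.1 h2).resolve_left (by positivity)

/-- A Lévy measure is determined by the measures with densities `osc w`. -/
lemma IsLevyMeasure.eq_of_weighted_osc {m₁ m₂ : Measure (E d)} (h₁ : IsLevyMeasure m₁)
    (h₂ : IsLevyMeasure m₂) (h : ∀ w, weighted m₁ (osc w) = weighted m₂ (osc w)) : m₁ = m₂ := by
  have hrec : ∀ (m : Measure (E d)) (w : E d), ((weighted m (osc w)).restrict
      {x | osc w x ≠ 0}).withDensity (fun x => ENNReal.ofReal (osc w x))⁻¹ =
      m.restrict {x | osc w x ≠ 0} := by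
    intro m w
    have hS : MeasurableSet {x | osc w x ≠ 0} :=
      (measurableSet_eq_fun (measurable_osc w) measurable_const).compl
    rw [weighted, restrict_withDensity hS]
    refine withDensity_inv_same (measurable_osc w).ennreal_ofReal ?_ (by simp)
    rw [ae_restrict_iff' hS]
    exact .of_forall fun x hx => by simpa using lt_of_le_of_ne (osc_nonneg w x) (Ne.symm hx)
  rw [← h₁.restrict_compl_zero, ← h₂.restrict_compl_zero, ← iUnion_osc_ne_zero, Measure.restrict_iUnion_congr]
  intro p
  rw [← hrec, h, hrec]

lemma levyTriplet_unique {c : E d → E d} (hc : IsRepresentationFunction c)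
    {A : Matrix (Fin d) (Fin d) ℝ} (hA : A.IsSymm) {m₁ m₂ : Measure (E d)} (γ : E d)
    (h₁ : IsLevyMeasure m₁) (h₂ : IsLevyMeasure m₂)
    (h : ∀ z, Complex.I * ((inner ℝ γ z : ℝ) : ℂ) -
      (1 / 2 : ℂ) * ((inner ℝ z (Matrix.toEuclideanLin A z) : ℝ) : ℂ) + levyInt c m₁ z =
        levyInt c m₂ z) : A = 0 ∧ m₁ = m₂ ∧ γ = 0 := by
  have key : ∀ w, (1 / 2 : ℝ) * inner ℝ w (Matrix.toEuclideanLin A w) = 0 ∧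
      weighted m₁ (osc w) = weighted m₂ (osc w) := fun w => by
    refine eq_zero_of_charFun_weighted_osc h₁ h₂ w fun z => ?_
    rw [← secondDiff_quadratic A γ w z, ← h₁.secondDiff_levyInt hc, ← h₂.secondDiff_levyInt hc,
      ← secondDiff_add, funext h]
  have hm : m₁ = m₂ := h₁.eq_of_weighted_osc h₂ fun w => (key w).2
  have hA0 : A = 0 := by
    have hsymm : (Matrix.toEuclideanLin A).IsSymmetric := Matrix.isSymmetric_toEuclideanLin_iff.2
      (by rwa [Matrix.IsHermitian, Matrix.conjTranspose_eq_transpose_of_trivial])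
    have h0 : Matrix.toEuclideanLin A = 0 := hsymm.inner_map_self_eq_zero.1 fun w => by
      rw [real_inner_comm]
      have := (key w).1
      linarith
    exact (LinearEquiv.map_eq_zero_iff _).1 h0
  refine ⟨hA0, hm, ?_⟩
  -- Once `A` and the Lévy integrals drop out, evaluation at `z = γ` leaves `i |γ|² = 0`.
  have h3 := h γ
  rw [hm, hA0] at h3
  simpa using h3

lemma exponent_eq (c : E d → E d) (A : Matrix (Fin d) (Fin d) ℝ) (ν : LocalSignedMeasure d)
    (γ z : E d) : exponent c A ν γ z = Complex.I * ((inner ℝ γ z : ℝ) : ℂ) -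
      (1 / 2 : ℂ) * ((inner ℝ z (Matrix.toEuclideanLin A z) : ℝ) : ℂ) +
        (levyInt c ν.posPart z - levyInt c ν.negPart z) := rfl

lemma continuous_exponent {c : E d → E d} (hc : IsRepresentationFunction c)
    (A : Matrix (Fin d) (Fin d) ℝ) {ν : LocalSignedMeasure d} (hν : ν.IsQuasiLevyType) (γ : E d) :
    Continuous (exponent c A ν γ) := by
  have h1 := hν.isLevyMeasure_posPart.continuous_levyInt hc
  have h2 := hν.isLevyMeasure_negPart.continuous_levyInt hc
  have h3 : Continuous (Matrix.toEuclideanLin A) := LinearMap.continuous_of_finiteDimensional _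
  rw [funext (exponent_eq c A ν γ)]
  fun_prop

lemma exponent_zero (c : E d → E d) (A : Matrix (Fin d) (Fin d) ℝ) (ν : LocalSignedMeasure d)
    (γ : E d) : exponent c A ν γ 0 = 0 := by
  simp [exponent_eq, levyInt_zero]

lemma levyInt_add_measure {c : E d → E d} (hc : IsRepresentationFunction c)
    {m₁ m₂ : Measure (E d)} (h₁ : IsLevyMeasure m₁) (h₂ : IsLevyMeasure m₂) (z : E d) :
    levyInt c (m₁ + m₂) z = levyInt c m₁ z + levyInt c m₂ z :=
  integral_add_measure (h₁.integrable_levyKernel hc z) (h₂.integrable_levyKernel hc z)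

lemma IsLevyMeasure.add {m₁ m₂ : Measure (E d)} (h₁ : IsLevyMeasure m₁) (h₂ : IsLevyMeasure m₂) :
    IsLevyMeasure (m₁ + m₂) :=
  ⟨by simp [h₁.zero, h₂.zero], h₁.integrable.add_measure h₂.integrable⟩

lemma LocalSignedMeasure.eq_of_parts {ν₁ ν₂ : LocalSignedMeasure d} (h₁ : ν₁.IsQuasiLevyType)
    (h₂ : ν₂.IsQuasiLevyType) (h : ν₁.posPart + ν₂.negPart = ν₂.posPart + ν₁.negPart) :
    ν₁ = ν₂ := by
  ext B
  have hB := congrArg (fun m : Measure (E d) => m.real B) h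
  beta_reduce at hB
  rw [measureReal_add_apply (h₁.isLevyMeasure_posPart.lt_top B.2).ne
      (h₂.isLevyMeasure_negPart.lt_top B.2).ne,
    measureReal_add_apply (h₂.isLevyMeasure_posPart.lt_top B.2).ne
      (h₁.isLevyMeasure_negPart.lt_top B.2).ne] at hB
  rw [toFun_eq_sub, toFun_eq_sub]
  linarith

lemma HasLevyKhintchineRep.unique {c : E d → E d} (hc : IsRepresentationFunction c)
    {μ : Measure (E d)} {A₁ A₂ : Matrix (Fin d) (Fin d) ℝ} {ν₁ ν₂ : LocalSignedMeasure d}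
    {γ₁ γ₂ : E d} (h₁ : HasLevyKhintchineRep c μ A₁ ν₁ γ₁)
    (h₂ : HasLevyKhintchineRep c μ A₂ ν₂ γ₂) : A₁ = A₂ ∧ ν₁ = ν₂ ∧ γ₁ = γ₂ := by
  obtain ⟨hA₁, hν₁, hμ₁⟩ := h₁
  obtain ⟨hA₂, hν₂, hμ₂⟩ := h₂
  have hexp : exponent c A₁ ν₁ γ₁ = exponent c A₂ ν₂ γ₂ :=
    eq_of_exp_eq (continuous_exponent hc A₁ hν₁ γ₁) (continuous_exponent hc A₂ hν₂ γ₂)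
      (by rw [exponent_zero, exponent_zero]) fun z => by rw [← hμ₁, ← hμ₂]
  have hp₁ := hν₁.isLevyMeasure_posPart
  have hn₁ := hν₁.isLevyMeasure_negPart
  have hp₂ := hν₂.isLevyMeasure_posPart
  have hn₂ := hν₂.isLevyMeasure_negPart
  -- Negative parts change sides, so that only genuine Lévy measures are compared.
  obtain ⟨hA, hm, hγ⟩ := levyTriplet_unique hc (A := A₁ - A₂) (hA₁.sub hA₂) (γ₁ - γ₂)
    (hp₁.add hn₂) (hp₂.add hn₁) fun z => by
      have h := congrFun hexp z
      rw [exponent_eq, exponent_eq] at h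
      rw [levyInt_add_measure hc hp₁ hn₂, levyInt_add_measure hc hp₂ hn₁, map_sub,
        LinearMap.sub_apply, inner_sub_left, inner_sub_right]
      push_cast
      linear_combination h
  exact ⟨sub_eq_zero.1 hA, LocalSignedMeasure.eq_of_parts hν₁ hν₂ hm, sub_eq_zero.1 hγ⟩

/-! ### Existence of the triplet -/

lemma IsQuasiInfinitelyDivisible.exists_rep {μ : Measure (E d)}
    (h : IsQuasiInfinitelyDivisible μ) {c : E d → E d} (hc : IsRepresentationFunction c) :
    ∃ (A : Matrix (Fin d) (Fin d) ℝ) (ν : LocalSignedMeasure d) (γ : E d),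
      HasLevyKhintchineRep c μ A ν γ := by
  obtain ⟨-, μ₁, μ₂, hμ₁, hμ₂, hμ⟩ := h
  obtain ⟨A₁, m₁, γ₁, hA₁, hm₁, h₁⟩ := hμ₁.exists_levyKhintchine hc
  obtain ⟨A₂, m₂, γ₂, hA₂, hm₂, h₂⟩ := hμ₂.exists_levyKhintchine hc
  refine ⟨A₁ - A₂, .ofLevy hm₁ hm₂, γ₁ - γ₂, hA₁.sub hA₂,
    LocalSignedMeasure.isQuasiLevyType_ofLevy hm₁ hm₂, fun z => ?_⟩
  have h3 : (LocalSignedMeasure.ofLevy hm₁ hm₂).integral (levyKernel c z) =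
      levyInt c m₁ z - levyInt c m₂ z :=
    LocalSignedMeasure.integral_ofLevy hm₁ hm₂ (hm₁.integrable_levyKernel hc z)
      (hm₂.integrable_levyKernel hc z)
  have h4 : exponent c (A₁ - A₂) (.ofLevy hm₁ hm₂) (γ₁ - γ₂) z =
      Complex.I * ((inner ℝ (γ₁ - γ₂) z : ℝ) : ℂ) - (1 / 2 : ℂ) *
        ((inner ℝ z (Matrix.toEuclideanLin (A₁ - A₂) z) : ℝ) : ℂ) +
          (LocalSignedMeasure.ofLevy hm₁ hm₂).integral (levyKernel c z) := rfl
  rw [hμ, h₁, h₂, ← Complex.exp_sub, h4, h3, map_sub, LinearMap.sub_apply, inner_sub_left,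
    inner_sub_right]
  congr 1
  push_cast
  ring

lemma HasLevyKhintchineRep.isQuasiInfinitelyDivisible {c : E d → E d}
    (hc : IsRepresentationFunction c) {μ : Measure (E d)} (hμ : IsProbabilityMeasure μ)
    {A : Matrix (Fin d) (Fin d) ℝ} {ν : LocalSignedMeasure d} {γ : E d}
    (h : HasLevyKhintchineRep c μ A ν γ) : IsQuasiInfinitelyDivisible μ := by
  obtain ⟨hA, hν, hexp⟩ := h
  have hone : (1 : Matrix (Fin d) (Fin d) ℝ).IsSymm := Matrix.isSymm_one
  obtain ⟨μ₁, hμ₁, h₁⟩ := hν.isLevyMeasure_posPart.exists_infinitelyDivisible hc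
    ((hA.add hone).smul (1 / 2 : ℝ)) γ
  obtain ⟨μ₂, hμ₂, h₂⟩ := hν.isLevyMeasure_negPart.exists_infinitelyDivisible hc
    ((hA.sub hone).smul (1 / 2 : ℝ)) 0
  refine ⟨hμ, μ₁, μ₂, hμ₁, hμ₂, fun z => ?_⟩
  -- `A = ((A + 1) / 2)² - ((A - 1) / 2)²` writes any symmetric matrix as a difference of two
  -- Gaussian covariances, without diagonalisation.
  have hsq : ((1 / 2 : ℝ) • (A + 1)) * ((1 / 2 : ℝ) • (A + 1)) =
      A + ((1 / 2 : ℝ) • (A - 1)) * ((1 / 2 : ℝ) • (A - 1)) := by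
    simp only [Matrix.smul_mul, Matrix.mul_smul, add_mul, mul_add, sub_mul, mul_sub,
      mul_one, one_mul]
    module
  rw [hexp, h₁, h₂, ← Complex.exp_sub, exponent_eq, hsq, map_add, LinearMap.add_apply,
    inner_add_right, inner_zero_left]
  congr 1
  push_cast
  ring

end QID

theorem theorem2p1 (d : ℕ) (c : QID.E d → QID.E d) (hc : QID.IsRepresentationFunction c)
    (μ : Measure (QID.E d)) (hμ : IsProbabilityMeasure μ) :
    (QID.IsQuasiInfinitelyDivisible μ ↔
      ∃ (A : Matrix (Fin d) (Fin d) ℝ) (ν : QID.LocalSignedMeasure d) (γ : QID.E d),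
        QID.HasLevyKhintchineRep c μ A ν γ) ∧
    (∀ (A₁ A₂ : Matrix (Fin d) (Fin d) ℝ) (ν₁ ν₂ : QID.LocalSignedMeasure d) (γ₁ γ₂ : QID.E d),
      QID.HasLevyKhintchineRep c μ A₁ ν₁ γ₁ → QID.HasLevyKhintchineRep c μ A₂ ν₂ γ₂ →
        A₁ = A₂ ∧ ν₁ = ν₂ ∧ γ₁ = γ₂) :=
  ⟨⟨fun h => h.exists_rep hc, fun ⟨_, _, _, h⟩ => h.isQuasiInfinitelyDivisible hc hμ⟩,
    fun _ _ _ _ _ _ h₁ h₂ => h₁.unique hc h₂⟩
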